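/- \textbf{Setting.} Let $F:\mathbb{R}^d\to\mathbb{R}$ ($d\ge 1$) be differentiable, let $w$ be the current SGD iterate, and let $M(w)$ be a positive definite diagonal $d\times d$ matrix, $S(w)=\mathrm{Tr}\,M(w)$. Write $\mathbb{E}_w$ for expectation conditional on $w$. A stochastic gradient of fidelity $\theta>0$ is $\nabla F(w)+U$, where $U$ has mean $0$ and covariance matrix $\theta^{-1}M(w)$, and each coordinate is sub-Gaussian: $\mathbb{E}_w e^{\lambda U_i}\le e^{\lambda^2M(w)_{ii}/(2\theta)}$ for all $\lambda\in\mathbb{R}$. It costs $C(\theta)$, where $C$ is strictly increasing on $(0,\infty)$ with $\lim_{\theta\to0}C(\theta)=c_{\min}\ge0$; averaging $n$ stochastic gradients costs $D(n)$, where $D$ is increasing and $D(1)=0$. Given a budget $B>0$, let $N=\max\{n\ge1: B>nc_{\min}+D(n)\}$ (assumed to exist) and, for $n\in[N]=\{1,\dots,N\}$, let $\theta_n=C^{-1}\big((B-D(n))/n\big)$ (the argument being assumed to lie in the range of $C$), $\sigma_n^2=1/(n\theta_n)$, $n_*\in\arg\min_{n\in[N]}\sigma_n^2$, $\sigma_*^2=\sigma_{n_*}^2$,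 and $\Delta_n=\sigma_n^2-\sigma_*^2$. A query of the oracle with mini-batch size $n$ returns the average of $n$ stochastic gradients of fidelity $\theta_n$; the perturbations of all the stochastic gradients are independent. Let $\alpha>2$, let $\beta\ge\sigma_n^2$ for all $n\in[N]$, let $P\ge S(w)$, and for a constant $c>0$ put $$f(x)=\beta P\sqrt{\tfrac{xd}{c}}\,\max\Big(1,\sqrt{\tfrac{x}{cd}}\Big),\qquad \varphi(\varepsilon)=\frac{c\,\varepsilon}{\beta P}\min\Big(1,\frac{\varepsilon/d}{\beta P}\Big).$$ EE-Grad with parameters $\alpha,\beta,P,c$ works in rounds. In round $t$ it picks a size $n_t\in[N]$, using only the past choices and observations (and possibly external randomness, independent of the perturbations, for breaking ties), and queries the oracle with that size, which returns $G_t(w)$. In the first $2N$ rounds it picks each size exactly twice; in round $t>2N$ it picks $$n_t\in\arg\min_{n\in[N]}\Big[V(n)-f\Big(\frac{\alpha\ln t}{\gamma(n)-1}\Big)\Big],$$ where $\gamma(n)$ is the number of earlier rounds in which size $n$ was picked and $V(n)$ is the trace of the (unbiased) sample covariance matrix of the outputs returned in those rounds. After $T\ge1$ rounds it outputs $G(w)=\frac1T\sum_{t=1}^TG_t(w)$.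 The optimal mini-batch oracle outputs the average $G^*(w)$ of $T$ independent outputs of the oracle with size $n_*$. \textbf{Theorem.} There is a universal constant $c>0$ (independent of all the data above) such that, on each SGD iteration, the estimate $G(w)$ of EE-Grad with this $c$ satisfies $$\mathbb{E}_w\|G(w)-\nabla F(w)\|_2^2\le Z_T(w)\,S(w),\qquad Z_T(w)=\frac{\sigma_*^2}{T}+\frac{\ln T}{T^2}\,C_1(w)+\frac{C_2}{T^2},$$ where $$C_1(w)=\sum_{n:\Delta_n>0}\frac{\alpha\Delta_n}{\varphi(\Delta_nS(w)/2)},\qquad C_2=\Big(\sum_{n=1}^N\Delta_n\Big)\frac{2(\alpha-1)}{\alpha-2},$$ and the optimal mini-batch oracle satisfies $$\mathbb{E}_w\|G^*(w)-\nabla F(w)\|_2^2=\frac{\sigma_*^2}{T}\,S(w).$$ -/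

import Mathlib

open MeasureTheory ProbabilityTheory
open scoped Topology

namespace EEGrad

noncomputable section

/-- A cost-fidelity model: a stochastic gradient of fidelity `θ > 0` costs `C θ`, aggregating `n`
of them costs `D n`, the budget per round is `B`, and `N` is the maximum feasible mini-batch
size. The last field says that `C⁻¹ ((B - D n) / n)` makes sense for the feasible sizes. -/
structure CostModel where
  C : ℝ → ℝ
  cmin : ℝ
  D : ℕ → ℝ
  B : ℝ
  N : ℕ
  C_strictMono : StrictMonoOn C (Set.Ioi 0)
  C_tendsto : Filter.Tendsto C (𝓝[>] 0) (𝓝 cmin)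
  cmin_nonneg : 0 ≤ cmin
  D_mono : MonotoneOn D (Set.Ici 1)
  D_one : D 1 = 0
  B_pos : 0 < B
  N_isGreatest : IsGreatest {n : ℕ | 1 ≤ n ∧ n * cmin + D n < B} N
  attained : ∀ n ∈ Finset.Icc 1 N, (B - D n) / n ∈ C '' Set.Ioi 0

/-- The feasible mini-batch sizes `1, …, N`. -/
abbrev BatchSize (N : ℕ) : Type := ↥(Finset.Icc 1 N)

/-- The fidelity `θ_n = C⁻¹ ((B - D n) / n)`; the inverse is taken on the fidelities `θ > 0`. -/
def CostModel.fidelity (K : CostModel) (n : ℕ) : ℝ :=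
  Function.invFunOn K.C (Set.Ioi 0) ((K.B - K.D n) / n)

/-- `σ_n² = 1 / (n θ_n)`. -/
def CostModel.sigmaSq (K : CostModel) (n : ℕ) : ℝ := 1 / (n * K.fidelity n)

/-- `nStar` is an optimal mini-batch size: it minimizes `σ_n²` over `n = 1, …, N`. -/
def CostModel.IsOptimal (K : CostModel) (nStar : BatchSize K.N) : Prop :=
  ∀ n : BatchSize K.N, K.sigmaSq nStar ≤ K.sigmaSq n

/-- The suboptimality gap `Δ_n = σ_n² - σ_*²`. -/
def CostModel.gap (K : CostModel) (nStar n : BatchSize K.N) : ℝ :=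
  K.sigmaSq n - K.sigmaSq nStar

/-- The perturbation of a stochastic gradient with fidelity `θ`: zero mean, covariance matrix
`θ⁻¹ M`, and `i`-th coordinate sub-Gaussian with parameter `θ⁻¹ M i i`
(the parameter of `HasSubgaussianMGF` is the variance proxy). -/
structure IsGradientNoise {Ω : Type*} [MeasurableSpace Ω] {d : ℕ} (μ : Measure Ω)
    (M : Matrix (Fin d) (Fin d) ℝ) (θ : ℝ) (U : Ω → EuclideanSpace ℝ (Fin d)) : Prop where
  measurable : Measurable U
  mean_zero : ∀ i, ∫ ω, U ω i ∂μ = 0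
  covariance : ∀ i j, ∫ ω, U ω i * U ω j ∂μ = θ⁻¹ * M i j
  subGaussian : ∀ i, HasSubgaussianMGF (fun ω => U ω i) (Real.toNNReal (θ⁻¹ * M i i)) μ

/-- Index of an individual perturbation: the mini-batch size `n`, the number of earlier queries of
the oracle with that size, and the position in the mini-batch. -/
abbrev NoiseIndex (N : ℕ) : Type := (n : BatchSize N) × (ℕ × Fin (n : ℕ))

section Run

variable {Ω : Type*} {d N : ℕ}

/-- The output `G_{s+1}(w, n) = (1/n) ∑ j, (∇F(w) + U_j)` of the oracle with mini-batch size `n` at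
its `(s+1)`-st query, where `g` is the true gradient and `U` collects the perturbations. -/
def oracle (g : EuclideanSpace ℝ (Fin d)) (U : NoiseIndex N → Ω → EuclideanSpace ℝ (Fin d))
    (n : BatchSize N) (s : ℕ) (ω : Ω) : EuclideanSpace ℝ (Fin d) :=
  (1 / ((n : ℕ) : ℝ)) • ∑ j : Fin (n : ℕ), (g + U ⟨n, s, j⟩ ω)

/-- The sample mean of the first `k` outputs of the oracle with mini-batch size `n`. -/
def sampleMean (g : EuclideanSpace ℝ (Fin d)) (U : NoiseIndex N → Ω → EuclideanSpace ℝ (Fin d))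
    (n : BatchSize N) (k : ℕ) (ω : Ω) : EuclideanSpace ℝ (Fin d) :=
  (1 / (k : ℝ)) • ∑ s ∈ Finset.range k, oracle g U n s ω

/-- The sample covariance matrix of the first `k` outputs of the oracle with size `n`. -/
def sampleCov (g : EuclideanSpace ℝ (Fin d)) (U : NoiseIndex N → Ω → EuclideanSpace ℝ (Fin d))
    (n : BatchSize N) (k : ℕ) (ω : Ω) : Matrix (Fin d) (Fin d) ℝ :=
  (1 / ((k : ℝ) - 1)) • ∑ s ∈ Finset.range k,
    Matrix.vecMulVec (fun i => oracle g U n s ω i - sampleMean g U n k ω i)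
      (fun i => oracle g U n s ω i - sampleMean g U n k ω i)

/-- `γ_t(n)`: how often size `n` was picked in the first `t` rounds. Rounds are numbered from `0`
in the code, so `pick t` is the choice `n_{t+1}` made in the `(t+1)`-st round. -/
def pulls (pick : ℕ → Ω → BatchSize N) (t : ℕ) (n : BatchSize N) (ω : Ω) : ℕ :=
  ((Finset.range t).filter fun r => pick r ω = n).card

/-- `V_t(n)`: the trace of the sample covariance matrix of the outputs that the oracle with size `n`
returned in the first `t` rounds. -/
def sampleTrace (g : EuclideanSpace ℝ (Fin d)) (U : NoiseIndex N → Ω → EuclideanSpace ℝ (Fin d))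
    (pick : ℕ → Ω → BatchSize N) (t : ℕ) (n : BatchSize N) (ω : Ω) : ℝ :=
  (sampleCov g U n (pulls pick t n ω) ω).trace

/-- The stochastic gradient returned in the `(t+1)`-st round: the next output of the oracle with the
mini-batch size that was picked. -/
def roundOutput (g : EuclideanSpace ℝ (Fin d)) (U : NoiseIndex N → Ω → EuclideanSpace ℝ (Fin d))
    (pick : ℕ → Ω → BatchSize N) (t : ℕ) (ω : Ω) : EuclideanSpace ℝ (Fin d) :=
  oracle g U (pick t ω) (pulls pick t (pick t ω) ω) ω

/-- The gradient estimate `(1/T) ∑ G_t` after `T` rounds. -/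
def estimate (g : EuclideanSpace ℝ (Fin d)) (U : NoiseIndex N → Ω → EuclideanSpace ℝ (Fin d))
    (pick : ℕ → Ω → BatchSize N) (T : ℕ) (ω : Ω) : EuclideanSpace ℝ (Fin d) :=
  (1 / (T : ℝ)) • ∑ t ∈ Finset.range T, roundOutput g U pick t ω

/-- The estimate of the optimal mini-batch oracle after `T` rounds: the average of `T` outputs of
the oracle with mini-batch size `nStar`. -/
def optimalEstimate (g : EuclideanSpace ℝ (Fin d))
    (U : NoiseIndex N → Ω → EuclideanSpace ℝ (Fin d)) (nStar : BatchSize N) (T : ℕ) (ω : Ω) :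
    EuclideanSpace ℝ (Fin d) :=
  (1 / (T : ℝ)) • ∑ s ∈ Finset.range T, oracle g U nStar s ω

end Run

/-- `f(x) = β P √(x d / c) max(1, √(x / (c d)))`. -/
def bonus (c β P : ℝ) (d : ℕ) (x : ℝ) : ℝ :=
  β * P * √(x * d / c) * max 1 √(x / (c * d))

/-- `φ(ε) = (c ε / (β P)) min(1, (ε / d) / (β P))`. -/
def phi (c β P : ℝ) (d : ℕ) (ε : ℝ) : ℝ :=
  c * ε / (β * P) * min 1 (ε / d / (β * P))

/-- `pick` is a run of EE-Grad. Every choice depends on the observed history only, up to a random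
`seed` that may serve to break ties; the first `2N` rounds query each oracle exactly twice; in each
later round, the `(t+1)`-st say, the choice minimizes
`V_t(n) - f(α ln(t+1) / (γ_t(n) - 1))`. -/
structure IsRun {Ω Ξ : Type*} [MeasurableSpace Ξ] {d N : ℕ} (c α β P : ℝ)
    (g : EuclideanSpace ℝ (Fin d)) (U : NoiseIndex N → Ω → EuclideanSpace ℝ (Fin d))
    (seed : Ω → Ξ)
    (rule : (t : ℕ) → Ξ × (Fin t → BatchSize N × EuclideanSpace ℝ (Fin d)) → BatchSize N)
    (pick : ℕ → Ω → BatchSize N) : Prop where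
  rule_measurable : ∀ t, Measurable (rule t)
  nonanticipating : ∀ t ω,
    pick t ω = rule t (seed ω, fun r : Fin t => (pick r ω, roundOutput g U pick r ω))
  init : ∀ n ω, pulls pick (2 * N) n ω = 2
  select : ∀ t, 2 * N ≤ t → ∀ ω, ∀ n : BatchSize N,
    sampleTrace g U pick t (pick t ω) ω -
        bonus c β P d (α * Real.log ((t : ℝ) + 1) / ((pulls pick t (pick t ω) ω : ℝ) - 1)) ≤
      sampleTrace g U pick t n ω -
        bonus c β P d (α * Real.log ((t : ℝ) + 1) / ((pulls pick t n ω : ℝ) - 1))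

/-- `C₁ = ∑_{n : Δ_n > 0} α Δ_n / φ(Δ_n S / 2)`. -/
def constC₁ (K : CostModel) (nStar : BatchSize K.N) (c α β P : ℝ) (d : ℕ) (S : ℝ) : ℝ :=
  ∑ n : BatchSize K.N with 0 < K.gap nStar n,
    α * K.gap nStar n / phi c β P d (K.gap nStar n * S / 2)

/-- `C₂ = (∑ n, Δ_n) · 2(α - 1)/(α - 2)`. -/
def constC₂ (K : CostModel) (nStar : BatchSize K.N) (α : ℝ) : ℝ :=
  (∑ n : BatchSize K.N, K.gap nStar n) * (2 * (α - 1) / (α - 2))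

/-- `Z_T = σ_*²/T + (ln T/T²) C₁ + C₂/T²`. -/
def boundZ (K : CostModel) (nStar : BatchSize K.N) (c α β P : ℝ) (d : ℕ) (S : ℝ) (T : ℕ) : ℝ :=
  K.sigmaSq nStar / T + Real.log T / (T : ℝ) ^ 2 * constC₁ K nStar c α β P d S +
    1 / (T : ℝ) ^ 2 * constC₂ K nStar α

end

end EEGrad

/-!
EE-Grad is a bandit algorithm in which pulling the arm `n` returns a vector with mean `∇F(w)` and
total variance `σ_n² S`, where `S = tr M(w)`, and the arm of least variance is wanted.

*Regret identity.* The outputs can be read off a table whose entry `(n, s)` is the output of the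
`(s+1)`-st query with size `n`; the run is a deterministic function (`history`) of the seed and this
table. Which entry is read next depends on the seed and the entries read before, so the entry is
independent of the past (`indepFun_next_query`). Hence the centred outputs form a martingale
(`integral_norm_sq_sum_outputs`), and the mean squared error of the average of `T` outputs is
`S / T²` times the expected sum of the `σ²` of the sizes picked (`estimate_error`). For the constant
choice `n_*` this is the claim on the optimal oracle; for EE-Grad it remains to bound, for `Δ_n > 0`,
the expected number of times that `n` is picked by `α ln T / φ(Δ_n S / 2) + 2(α - 1)/(α - 2)`.

*Concentration.* The squares of the coordinates of a centred output are sub-exponential at the scale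
of their mean (`mgf_sq_sub_le`). The same holds for the sums of squared deviations from the sample
mean, and, by Jensen's inequality, for their sum over the possibly dependent coordinates. The Chernoff
bound then shows that the trace of the sample covariance of `k` outputs deviates from `σ_n² S` by `ε`
with probability at most `exp (-(k - 1) φ(ε))` on either side (`sampleCov_trace_tail`). Here any
sufficiently small constant `c` will do; `c = 1 / 16384` comes out of the estimates.

*Pull count.* The bonus `f` is the inverse of `φ` (`phi_bonus`), so each deviation by the bonus
has probability at most `t ^ (-α)` in round `t`. A union bound over the number of pulls and a sum over
`t` bound the expected number of rounds with such a deviation by `2 / (α - 2)`. In the other rounds a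
suboptimal size is picked only while it has been pulled at most `α ln T / φ(Δ_n S / 2) + 1` times.
-/

namespace EEGrad

/-! ### Concentration of sums of squares of sub-Gaussian variables -/

section Concentration

variable {Ω : Type*} [MeasurableSpace Ω] {μ : Measure Ω}

lemma lintegral_exp_sq_gaussianReal :
    ∫⁻ z, ENNReal.ofReal (Real.exp (z ^ 2 / 4)) ∂(gaussianReal 0 1) = ENNReal.ofReal √2 := by
  rw [gaussianReal_of_var_ne_zero 0 one_ne_zero,
    lintegral_withDensity_eq_lintegral_mul _ (measurable_gaussianPDF 0 1) (by fun_prop)]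
  have h : ∀ z : ℝ, (gaussianPDF 0 1 * fun z => ENNReal.ofReal (Real.exp (z ^ 2 / 4))) z =
      ENNReal.ofReal ((√(2 * Real.pi))⁻¹ * Real.exp (-(1 / 4) * z ^ 2)) := by
    intro z
    rw [Pi.mul_apply, gaussianPDF, ← ENNReal.ofReal_mul (gaussianPDFReal_nonneg _ _ _),
      gaussianPDFReal, mul_assoc, ← Real.exp_add]
    congr 2
    · simp
    · congr 1
      simp
      ring
  rw [lintegral_congr h, ← ofReal_integral_eq_lintegral_ofReal, integral_const_mul,
    integral_gaussian]
  · congr 1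
    rw [← Real.sqrt_inv, ← Real.sqrt_mul (by positivity)]
    congr 1
    field_simp
    norm_num
  · exact (integrable_exp_neg_mul_sq (by norm_num)).const_mul _
  · exact ae_of_all _ fun z => by positivity

/-- The square of a sub-Gaussian variable has an exponential moment: writing `exp (X² / (4 v))` as
a Gaussian average of `exp (r z X)` reduces it to the moment-generating function of `X`. -/
lemma exp_sq_of_subGaussian {X : Ω → ℝ} {v : ℝ} (hv : 0 < v) (hX : Measurable X)
    [SFinite μ] (h : HasSubgaussianMGF X (Real.toNNReal v) μ) :
    Integrable (fun ω => Real.exp (X ω ^ 2 / (4 * v))) μ ∧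
      ∫ ω, Real.exp (X ω ^ 2 / (4 * v)) ∂μ ≤ √2 := by
  set r : ℝ := (√(2 * v))⁻¹ with hr
  have hr2 : r ^ 2 = 1 / (2 * v) := by
    rw [hr, inv_pow, Real.sq_sqrt (by positivity), one_div]
  have key : ∫⁻ ω, ENNReal.ofReal (Real.exp (X ω ^ 2 / (4 * v))) ∂μ ≤ ENNReal.ofReal √2 := by
    calc ∫⁻ ω, ENNReal.ofReal (Real.exp (X ω ^ 2 / (4 * v))) ∂μ
        = ∫⁻ ω, ∫⁻ z, ENNReal.ofReal (Real.exp (r * z * X ω)) ∂(gaussianReal 0 1) ∂μ := by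
          refine lintegral_congr fun ω => ?_
          rw [← ofReal_integral_eq_lintegral_ofReal]
          · congr 1
            have := congrFun (mgf_fun_id_gaussianReal (μ := 0) (v := 1)) (r * X ω)
            simp only [mgf] at this
            rw [show (fun z : ℝ => Real.exp (r * z * X ω)) =
              fun z => Real.exp (r * X ω * z) by ext z; ring_nf]
            rw [this]
            congr 1
            simp only [NNReal.coe_one, mul_pow, hr2]
            field_simp
            ring
          · have := integrable_exp_mul_gaussianReal (μ := 0) (v := 1) (r * X ω)
            refine this.congr (ae_of_all _ fun z => ?_)
            simp only
            ring_nf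
          · exact ae_of_all _ fun z => by positivity
      _ = ∫⁻ z, ∫⁻ ω, ENNReal.ofReal (Real.exp (r * z * X ω)) ∂μ ∂(gaussianReal 0 1) := by
          rw [lintegral_lintegral_swap]
          exact Measurable.aemeasurable (by fun_prop)
      _ ≤ ∫⁻ z, ENNReal.ofReal (Real.exp (z ^ 2 / 4)) ∂(gaussianReal 0 1) := by
          refine lintegral_mono fun z => ?_
          rw [← ofReal_integral_eq_lintegral_ofReal (h.integrable_exp_mul _)
            (ae_of_all _ fun z => by positivity)]
          refine ENNReal.ofReal_le_ofReal ((h.mgf_le (r * z)).trans_eq ?_)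
          congr 1
          rw [Real.coe_toNNReal _ hv.le, mul_pow, hr2]
          field_simp
          ring
      _ = ENNReal.ofReal √2 := lintegral_exp_sq_gaussianReal
  have hm : Measurable fun ω => Real.exp (X ω ^ 2 / (4 * v)) := by fun_prop
  have hint : Integrable (fun ω => Real.exp (X ω ^ 2 / (4 * v))) μ := by
    refine ⟨hm.aestronglyMeasurable, ?_⟩
    rw [hasFiniteIntegral_iff_ofReal (ae_of_all _ fun z => by positivity)]
    exact key.trans_lt ENNReal.ofReal_lt_top
  refine ⟨hint, ?_⟩
  rw [← ENNReal.ofReal_le_ofReal_iff (by positivity),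
    ofReal_integral_eq_lintegral_ofReal hint (ae_of_all _ fun z => by positivity)]
  exact key

/-- A second-order Taylor bound that is valid on the whole line. -/
lemma exp_le_quadratic (x : ℝ) : Real.exp x ≤ 1 + x + x ^ 2 * Real.exp |x| := by
  have h := Complex.norm_exp_sub_sum_le_norm_mul_exp (x : ℂ) 2
  have h' : ((Real.exp x - (1 + x) : ℝ) : ℂ) =
      Complex.exp x - ∑ m ∈ Finset.range 2, (x : ℂ) ^ m / m.factorial := by
    simp [Finset.sum_range_succ]
  rw [← h', Complex.norm_real, Complex.norm_real, Real.norm_eq_abs, Real.norm_eq_abs,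
    sq_abs] at h
  linarith [le_abs_self (Real.exp x - (1 + x))]

/-- The centred square of a sub-Gaussian variable, whose variance equals its variance proxy `v`, is
sub-exponential: near the origin its moment-generating function is at most that of a Gaussian with
variance of order `v²`. -/
lemma mgf_sq_sub_le [IsProbabilityMeasure μ] {X : Ω → ℝ} {v l : ℝ} (hv : 0 < v)
    (hX : Measurable X)
    (h : HasSubgaussianMGF X (Real.toNNReal v) μ) (hvar : ∫ ω, X ω ^ 2 ∂μ = v)
    (hl : |l| * v ≤ 1 / 8) :
    Integrable (fun ω => Real.exp (l * (X ω ^ 2 - v))) μ ∧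
      ∫ ω, Real.exp (l * (X ω ^ 2 - v)) ∂μ ≤ Real.exp (512 * (l * v) ^ 2) := by
  obtain ⟨hi, hle⟩ := exp_sq_of_subGaussian hv hX h
  have hsq : Integrable (fun ω => X ω ^ 2) μ := by
    have := h.memLp 2
    exact this.integrable_sq
  -- Taylor's formula, with the square in the remainder absorbed by the exponential moment of `X²`
  have hpt : ∀ ω, Real.exp (l * (X ω ^ 2 - v)) ≤ 1 + l * (X ω ^ 2 - v) +
      (l * v) ^ 2 * (256 * Real.exp (X ω ^ 2 / (4 * v))) := by
    intro ω
    set z : ℝ := |X ω ^ 2 - v| / v with hz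
    have hz0 : 0 ≤ z := by positivity
    have hz1 : z ≤ X ω ^ 2 / v + 1 := by
      rw [hz, div_le_iff₀ hv, add_mul, div_mul_cancel₀ _ hv.ne', one_mul, abs_le]
      constructor <;> nlinarith [sq_nonneg (X ω)]
    have h1 : z ^ 2 ≤ 128 * Real.exp (z / 8) := by
      have := Real.quadratic_le_exp_of_nonneg (x := z / 8) (by positivity)
      nlinarith
    have habs : |l * (X ω ^ 2 - v)| ≤ z / 8 := by
      rw [abs_mul, show |X ω ^ 2 - v| = v * z by rw [hz]; field_simp]
      nlinarith
    have hs : (l * (X ω ^ 2 - v)) ^ 2 = (l * v) ^ 2 * z ^ 2 := by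
      rw [hz, div_pow, sq_abs]; field_simp
    have hq : Real.exp (1 / 4) ≤ 2 := by
      have := Real.exp_bound_div_one_sub_of_interval (x := 1 / 4) (by norm_num) (by norm_num)
      linarith
    refine (exp_le_quadratic _).trans ?_
    rw [hs, mul_assoc]
    refine add_le_add le_rfl (mul_le_mul_of_nonneg_left ?_ (sq_nonneg _))
    calc z ^ 2 * Real.exp |l * (X ω ^ 2 - v)|
        ≤ 128 * Real.exp (z / 8) * Real.exp (z / 8) := by gcongr
      _ = 128 * Real.exp (z / 4) := by rw [mul_assoc, ← Real.exp_add]; ring_nf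
      _ ≤ 128 * Real.exp (1 / 4 + X ω ^ 2 / (4 * v)) := by
          gcongr
          have : X ω ^ 2 / (4 * v) = X ω ^ 2 / v / 4 := by field_simp
          rw [this]; linarith
      _ = 128 * (Real.exp (1 / 4) * Real.exp (X ω ^ 2 / (4 * v))) := by rw [Real.exp_add]
      _ ≤ 128 * (2 * Real.exp (X ω ^ 2 / (4 * v))) := by gcongr
      _ = 256 * Real.exp (X ω ^ 2 / (4 * v)) := by ring
  have hlin : Integrable (fun ω => 1 + l * (X ω ^ 2 - v)) μ :=
    (integrable_const _).add ((hsq.sub (integrable_const _)).const_mul _)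
  have hexp : Integrable (fun ω => (l * v) ^ 2 * (256 * Real.exp (X ω ^ 2 / (4 * v)))) μ :=
    (hi.const_mul _).const_mul _
  have hint : Integrable (fun ω => Real.exp (l * (X ω ^ 2 - v))) μ := by
    refine (hlin.add hexp).mono' (by fun_prop) (ae_of_all _ fun ω => ?_)
    rw [Real.norm_of_nonneg (by positivity)]
    exact hpt ω
  refine ⟨hint, (integral_mono hint (hlin.add hexp) hpt).trans ?_⟩
  have h0 : ∫ ω, (1 + l * (X ω ^ 2 - v)) ∂μ = 1 := by
    rw [integral_add (integrable_const _) (Integrable.const_mul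
      (f := fun ω => X ω ^ 2 - v) (hsq.sub (integrable_const _)) _), integral_const_mul,
      integral_sub hsq (integrable_const _), hvar]
    simp
  have h2 : √2 ≤ 2 := by
    rw [Real.sqrt_le_left (by norm_num)]; norm_num
  calc ∫ ω, (1 + l * (X ω ^ 2 - v) + (l * v) ^ 2 * (256 * Real.exp (X ω ^ 2 / (4 * v)))) ∂μ
      = 1 + (l * v) ^ 2 * (256 * ∫ ω, Real.exp (X ω ^ 2 / (4 * v)) ∂μ) := by
        rw [integral_add hlin hexp, h0, integral_const_mul, integral_const_mul]
    _ ≤ 1 + (l * v) ^ 2 * (256 * 2) := by gcongr; exact hle.trans h2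
    _ ≤ Real.exp (512 * (l * v) ^ 2) := by
        have := Real.add_one_le_exp (512 * (l * v) ^ 2)
        linarith

/-- Moment-generating function of the centred sum of squared deviations
`∑ x_s² - (∑ x_s)² / k - (k - 1) v`. Convexity of `exp` separates the two quadratic terms, and
`(∑ x_s) / √k` is again sub-Gaussian with variance and variance proxy `v`. -/
lemma mgf_sum_sq_dev_le [IsProbabilityMeasure μ] {x : ℕ → Ω → ℝ} {v l : ℝ} (hv : 0 < v)
    (hx : ∀ s, Measurable (x s)) (hind : iIndepFun x μ)
    (h : ∀ s, HasSubgaussianMGF (x s) (Real.toNNReal v) μ)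
    (hmean : ∀ s, ∫ ω, x s ω ∂μ = 0)
    (hvar : ∀ s, ∫ ω, x s ω ^ 2 ∂μ = v) {k : ℕ} (hk : 2 ≤ k) (hl : |l| * v ≤ 1 / 16) :
    Integrable (fun ω => Real.exp (l * ((∑ s ∈ Finset.range k, x s ω ^ 2 -
        (∑ s ∈ Finset.range k, x s ω) ^ 2 / k) - (k - 1) * v))) μ ∧
      ∫ ω, Real.exp (l * ((∑ s ∈ Finset.range k, x s ω ^ 2 -
        (∑ s ∈ Finset.range k, x s ω) ^ 2 / k) - (k - 1) * v)) ∂μ ≤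
        Real.exp (4096 * (l * v) ^ 2 * (k - 1)) := by
  have hk0 : (0 : ℝ) < k := by positivity
  have hk2 : (2 : ℝ) ≤ k := by exact_mod_cast hk
  have hl2 : |2 * l| * v ≤ 1 / 8 := by rw [abs_mul, abs_two]; linarith
  have hl2' : |-2 * l| * v ≤ 1 / 8 := by rw [abs_mul, abs_neg, abs_two]; linarith
  have hL2 : ∀ s, MemLp (x s) 2 μ := fun s => (h s).memLp 2
  -- the sum of squares
  have hindsq : iIndepFun (fun s ω => x s ω ^ 2 - v) μ :=
    hind.comp (fun _ y => y ^ 2 - v) (fun _ => by fun_prop)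
  have hA : Integrable
      (fun ω => Real.exp (2 * l * (∑ s ∈ Finset.range k, (x s ω ^ 2 - v)))) μ := by
    have := hindsq.integrable_exp_mul_sum (t := 2 * l) (s := Finset.range k)
      (fun s => by fun_prop) (fun s _ => (mgf_sq_sub_le hv (hx s) (h s) (hvar s) hl2).1)
    simpa using this
  have hA' : ∫ ω, Real.exp (2 * l * (∑ s ∈ Finset.range k, (x s ω ^ 2 - v))) ∂μ ≤
      Real.exp (512 * (2 * l * v) ^ 2 * k) := by
    have := hindsq.mgf_sum (t := 2 * l) (fun s => by fun_prop) (Finset.range k)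
    simp only [mgf, Finset.sum_apply] at this
    rw [this]
    calc ∏ s ∈ Finset.range k, ∫ ω, Real.exp (2 * l * (x s ω ^ 2 - v)) ∂μ
        ≤ ∏ s ∈ Finset.range k, Real.exp (512 * (2 * l * v) ^ 2) := by
          refine Finset.prod_le_prod (fun s _ => integral_nonneg fun ω => by positivity)
            fun s _ => (mgf_sq_sub_le hv (hx s) (h s) (hvar s) hl2).2
      _ = Real.exp (512 * (2 * l * v) ^ 2 * k) := by
          rw [Finset.prod_const, Finset.card_range, ← Real.exp_nat_mul]; ring_nf
  -- the squared normalized sum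
  set Z : Ω → ℝ := fun ω => (√k)⁻¹ * ∑ s ∈ Finset.range k, x s ω with hZ
  have hZm : Measurable Z := by fun_prop
  have hZs : ∀ ω, Z ω ^ 2 = (∑ s ∈ Finset.range k, x s ω) ^ 2 / k := by
    intro ω
    rw [hZ, mul_pow, inv_pow, Real.sq_sqrt hk0.le]; field_simp
  have hZsub : HasSubgaussianMGF Z (Real.toNNReal v) μ := by
    have := (HasSubgaussianMGF.sum_of_iIndepFun hind (s := Finset.range k)
      (c := fun _ => Real.toNNReal v) (fun s _ => h s)).const_mul (√k)⁻¹
    convert! this using 1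
    rw [Finset.sum_const, Finset.card_range, nsmul_eq_mul]
    refine NNReal.eq ?_
    change (v.toNNReal : ℝ) = (√k)⁻¹ ^ 2 * ((k : ℝ) * v.toNNReal)
    rw [inv_pow, Real.sq_sqrt hk0.le]
    field_simp
  have hZvar : ∫ ω, Z ω ^ 2 ∂μ = v := by
    have hv1 : variance (fun ω => ∑ s ∈ Finset.range k, x s ω) μ = k * v := by
      have := IndepFun.variance_sum (X := x) (s := Finset.range k) (μ := μ) (fun s _ => hL2 s)
        (fun s _ t _ hst => hind.indepFun hst)
      rw [show (fun ω => ∑ s ∈ Finset.range k, x s ω) = ∑ s ∈ Finset.range k, x s by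
        ext ω; simp, this]
      rw [Finset.sum_congr rfl (g := fun _ => v)]
      · simp
      · intro s _
        rw [variance_of_integral_eq_zero (hx s).aemeasurable (hmean s), hvar]
    rw [variance_of_integral_eq_zero (by fun_prop)] at hv1
    · simp_rw [hZs]
      rw [integral_div, hv1]; field_simp
    · rw [integral_finsetSum _ fun s _ => (h s).integrable]
      simp [hmean]
  obtain ⟨hB, hB'⟩ := mgf_sq_sub_le hv hZm hZsub hZvar hl2'
  have hpt : ∀ ω, Real.exp (l * ((∑ s ∈ Finset.range k, x s ω ^ 2 -
      (∑ s ∈ Finset.range k, x s ω) ^ 2 / k) - (k - 1) * v)) ≤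
      (1 / 2) * Real.exp (2 * l * (∑ s ∈ Finset.range k, (x s ω ^ 2 - v))) +
      (1 / 2) * Real.exp (-2 * l * (Z ω ^ 2 - v)) := by
    intro ω
    have := convexOn_exp.2 (Set.mem_univ (2 * l * (∑ s ∈ Finset.range k, (x s ω ^ 2 - v))))
      (Set.mem_univ (-2 * l * (Z ω ^ 2 - v)))
      (one_half_pos (α := ℝ)).le (one_half_pos (α := ℝ)).le (add_halves 1)
    simp only [smul_eq_mul] at this
    refine le_trans (le_of_eq ?_) this
    congr 1
    rw [hZs, Finset.sum_sub_distrib, Finset.sum_const, Finset.card_range, nsmul_eq_mul]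
    ring
  have hsum := (hA.const_mul (1 / 2)).add (hB.const_mul (1 / 2))
  have hint : Integrable (fun ω => Real.exp (l * ((∑ s ∈ Finset.range k, x s ω ^ 2 -
        (∑ s ∈ Finset.range k, x s ω) ^ 2 / k) - (k - 1) * v))) μ := by
    refine hsum.mono' (by fun_prop) (ae_of_all _ fun ω => ?_)
    rw [Real.norm_of_nonneg (by positivity)]
    exact hpt ω
  refine ⟨hint, (integral_mono hint hsum hpt).trans ?_⟩
  simp only [Pi.add_apply]
  rw [integral_add (hA.const_mul _) (hB.const_mul _), integral_const_mul, integral_const_mul]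
  have e1 : Real.exp (512 * (2 * l * v) ^ 2 * k) ≤ Real.exp (4096 * (l * v) ^ 2 * (k - 1)) := by
    gcongr 1
    nlinarith [sq_nonneg (l * v)]
  have e2 : Real.exp (512 * (-2 * l * v) ^ 2) ≤ Real.exp (4096 * (l * v) ^ 2 * (k - 1)) := by
    gcongr 1
    nlinarith [sq_nonneg (l * v)]
  linarith

/-- The sub-exponential bound for the sum over coordinates, which need not be independent: Jensen's
inequality with the weights `v_i / V`, where `V = ∑ v_i`. -/
lemma mgf_sum_coord_le [IsProbabilityMeasure μ] {ι : Type*} [Fintype ι] {q : ι → Ω → ℝ}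
    {v : ι → ℝ} {V a C l : ℝ} (hv : ∀ i, 0 < v i) (hV : 0 < V) (hsum : ∑ i, v i = V)
    (hq : ∀ i, Measurable (q i))
    (h : ∀ i, ∀ l, |l| * v i ≤ a → Integrable (fun ω => Real.exp (l * q i ω)) μ ∧
      ∫ ω, Real.exp (l * q i ω) ∂μ ≤ Real.exp (C * (l * v i) ^ 2))
    (hl : |l| * V ≤ a) :
    Integrable (fun ω => Real.exp (l * ∑ i, q i ω)) μ ∧
      ∫ ω, Real.exp (l * ∑ i, q i ω) ∂μ ≤ Real.exp (C * (l * V) ^ 2) := by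
  have hw : ∑ i, v i / V = 1 := by rw [← Finset.sum_div, hsum, div_self hV.ne']
  have hi : ∀ i, Integrable (fun ω => Real.exp (l * V / v i * q i ω)) μ ∧
      ∫ ω, Real.exp (l * V / v i * q i ω) ∂μ ≤ Real.exp (C * (l * V) ^ 2) := by
    intro i
    have hvi := hv i
    have := h i (l * V / v i) (by
      rwa [abs_div, abs_mul, abs_of_pos hV, abs_of_pos hvi, div_mul_cancel₀ _ hvi.ne'])
    rwa [div_mul_cancel₀ _ hvi.ne'] at this
  have hpt : ∀ ω, Real.exp (l * ∑ i, q i ω) ≤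
      ∑ i, v i / V * Real.exp (l * V / v i * q i ω) := by
    intro ω
    have := convexOn_exp.map_sum_le (t := Finset.univ) (w := fun i => v i / V)
      (p := fun i => l * V / v i * q i ω) (fun i _ => (div_pos (hv i) hV).le) hw
      (fun i _ => Set.mem_univ _)
    simp only [smul_eq_mul] at this
    refine le_trans (le_of_eq ?_) this
    rw [Finset.mul_sum]
    congr 1
    refine Finset.sum_congr rfl fun i _ => ?_
    have := (hv i).ne'
    field_simp
  have hs : Integrable (fun ω => ∑ i, v i / V * Real.exp (l * V / v i * q i ω)) μ :=
    integrable_finsetSum _ fun i _ => (hi i).1.const_mul _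
  have hint : Integrable (fun ω => Real.exp (l * ∑ i, q i ω)) μ := by
    refine hs.mono' (by fun_prop) (ae_of_all _ fun ω => ?_)
    rw [Real.norm_of_nonneg (by positivity)]
    exact hpt ω
  refine ⟨hint, (integral_mono hint hs hpt).trans ?_⟩
  rw [integral_finsetSum _ fun i _ => (hi i).1.const_mul _]
  calc ∑ i, ∫ ω, v i / V * Real.exp (l * V / v i * q i ω) ∂μ
      ≤ ∑ i, v i / V * Real.exp (C * (l * V) ^ 2) := by
        refine Finset.sum_le_sum fun i _ => ?_
        rw [integral_const_mul]
        exact mul_le_mul_of_nonneg_left (hi i).2 (div_pos (hv i) hV).le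
    _ = Real.exp (C * (l * V) ^ 2) := by rw [← Finset.sum_mul, hw, one_mul]

/-- Chernoff bound for a sub-exponential variable at scale `b`, with the quadratic and the linear
regime merged into `y * min 1 y`. -/
lemma tail_le_of_mgf_le [IsProbabilityMeasure μ] {Y : Ω → ℝ} {V b m y : ℝ}
    (hV : 0 < V) (hVb : V ≤ b) (hm : 0 ≤ m) (hy : 0 ≤ y)
    (h : ∀ l, |l| * V ≤ 1 / 16 → Integrable (fun ω => Real.exp (l * Y ω)) μ ∧
      ∫ ω, Real.exp (l * Y ω) ∂μ ≤ Real.exp (4096 * m * (l * V) ^ 2)) :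
    μ.real {ω | m * (b * y) ≤ Y ω} ≤ Real.exp (-(m * (1 / 16384 * (y * min 1 y)))) ∧
      μ.real {ω | Y ω ≤ -(m * (b * y))} ≤ Real.exp (-(m * (1 / 16384 * (y * min 1 y)))) := by
  have hb : 0 < b := hV.trans_le hVb
  set p : ℝ := min 1 y with hp
  have hp0 : 0 ≤ p := le_min zero_le_one hy
  have hp1 : p ≤ 1 := min_le_left _ _
  have hpy : p ≤ y := min_le_right _ _
  -- `8192 = 2 * 4096` optimizes the exponent `-l b y + 4096 (l b)²` in the quadratic regime
  set l : ℝ := 1 / 8192 * p / b with hl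
  have hl0 : 0 ≤ l := by positivity
  have hlb : l * b = 1 / 8192 * p := by rw [hl]; field_simp
  have hlV : l * V ≤ 1 / 8192 * p := hlb ▸ mul_le_mul_of_nonneg_left hVb hl0
  have hlV0 : 0 ≤ l * V := by positivity
  have hexp : -l * (m * (b * y)) + 4096 * m * (l * V) ^ 2 ≤ -(m * (1 / 16384 * (y * p))) := by
    have h1 : (l * V) ^ 2 ≤ (1 / 8192) ^ 2 * (y * p) := by
      calc (l * V) ^ 2 ≤ (1 / 8192 * p) ^ 2 := by gcongr
        _ = (1 / 8192) ^ 2 * (p * p) := by ring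
        _ ≤ (1 / 8192) ^ 2 * (y * p) := by gcongr
    have h2 : -l * (m * (b * y)) = -(m * (1 / 8192 * p * y)) := by rw [← hlb]; ring
    rw [h2]
    have h3 := mul_le_mul_of_nonneg_left h1 hm
    nlinarith
  have hc1 : |l| * V ≤ 1 / 16 := by rw [abs_of_nonneg hl0]; linarith
  have hc2 : |-l| * V ≤ 1 / 16 := by rw [abs_neg]; exact hc1
  constructor
  · obtain ⟨hi, hle⟩ := h l hc1
    refine (measure_ge_le_exp_mul_mgf _ hl0 hi).trans ?_
    calc Real.exp (-l * (m * (b * y))) * mgf Y μ l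
        ≤ Real.exp (-l * (m * (b * y))) * Real.exp (4096 * m * (l * V) ^ 2) := by
          gcongr; exact hle
      _ ≤ _ := by rw [← Real.exp_add]; gcongr
  · obtain ⟨hi, hle⟩ := h (-l) hc2
    refine (measure_le_le_exp_mul_mgf _ (neg_nonpos.mpr hl0) hi).trans ?_
    rw [neg_mul, neg_sq] at hle
    calc Real.exp (-(-l) * (-(m * (b * y)))) * mgf Y μ (-l)
        ≤ Real.exp (-(-l) * (-(m * (b * y)))) * Real.exp (4096 * m * (l * V) ^ 2) := by
          gcongr; exact hle
      _ ≤ _ := by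
          rw [← Real.exp_add]
          gcongr
          linarith

end Concentration

/-! ### Independence of blocks and of single entries -/

section Independence

variable {Ω : Type*} [MeasurableSpace Ω] {μ : Measure Ω}

/-- The converse of `iIndepFun_uncurry`: disjoint blocks of an independent family are
independent. -/
lemma iIndepFun_blocks {ι : Type*} {κ : ι → Type*} {E : Type*} [MeasurableSpace E]
    {X : ((i : ι) × κ i) → Ω → E} (hX : ∀ p, Measurable (X p)) (h : iIndepFun X μ) :
    iIndepFun (fun i ω (j : κ i) => X ⟨i, j⟩ ω) μ := by
  have := h.isProbabilityMeasure
  have : ∀ i j, IsProbabilityMeasure (μ.map (X ⟨i, j⟩)) :=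
    fun i j => Measure.isProbabilityMeasure_map (hX _).aemeasurable
  rw [iIndepFun_iff_map_fun_eq_infinitePi_map (by fun_prop)]
  have hc : (MeasurableEquiv.piCurry fun i (_ : κ i) => E) ∘ (fun ω p => X p ω) =
      fun ω i j => X ⟨i, j⟩ ω := by
    ext; simp [Sigma.curry]
  rw [← hc, ← Measure.map_map (by fun_prop) (by fun_prop), h.map_fun_eq_infinitePi_map hX]
  have := Measure.infinitePi_map_piCurry (X := fun i (_ : κ i) => E)
    (fun i j => μ.map (X ⟨i, j⟩))
  rw [this]
  congr 1
  ext1 i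
  have hi : iIndepFun (fun j : κ i => X ⟨i, j⟩) μ := h.precomp sigma_mk_injective
  rw [hi.map_fun_eq_infinitePi_map fun j => hX _]

lemma indepFun_prodMk_of_indepFun {α β γ : Type*} [MeasurableSpace α] [MeasurableSpace β]
    [MeasurableSpace γ] [IsProbabilityMeasure μ] {A : Ω → α} {B : Ω → β} {W : Ω → γ}
    (hA : Measurable A) (hB : Measurable B) (hW : Measurable W) (hAB : IndepFun A B μ)
    (hWAB : IndepFun W (fun ω => (A ω, B ω)) μ) : IndepFun A (fun ω => (W ω, B ω)) μ := by
  have : IsProbabilityMeasure (μ.map A) := Measure.isProbabilityMeasure_map hA.aemeasurable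
  have : IsProbabilityMeasure (μ.map B) := Measure.isProbabilityMeasure_map hB.aemeasurable
  have : IsProbabilityMeasure (μ.map W) := Measure.isProbabilityMeasure_map hW.aemeasurable
  have hWB : IndepFun W B μ := hWAB.comp measurable_id measurable_snd
  rw [indepFun_iff_map_prod_eq_prod_map_map (by fun_prop) (by fun_prop)] at hAB hWAB hWB ⊢
  rw [hWB]
  rw [hAB] at hWAB
  have h1 : μ.map (fun ω => (A ω, W ω, B ω)) =
      ((μ.map (fun ω => (W ω, A ω, B ω))).map MeasurableEquiv.prodAssoc.symm).map
        (fun p : (γ × α) × β => (p.1.2, p.1.1, p.2)) := by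
    rw [Measure.map_map (by fun_prop) (by fun_prop), Measure.map_map (by fun_prop) (by fun_prop)]
    rfl
  have h2 : (fun p : (γ × α) × β => (p.1.2, p.1.1, p.2)) =
      MeasurableEquiv.prodAssoc ∘ Prod.map Prod.swap id := by
    ext p <;> rfl
  rw [h1, hWAB, h2, ← Measure.map_map (by fun_prop) (by fun_prop)]
  have h3 : ((μ.map W).prod ((μ.map A).prod (μ.map B))).map MeasurableEquiv.prodAssoc.symm =
      ((μ.map W).prod (μ.map A)).prod (μ.map B) := by
    rw [MeasurableEquiv.map_apply_eq_iff_map_symm_apply_eq]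
    exact (measurePreserving_prodAssoc _ _ _).map_eq.symm
  rw [h3, ← Measure.map_prod_map _ _ measurable_swap measurable_id, Measure.prod_swap,
    Measure.map_id]
  exact (measurePreserving_prodAssoc _ _ _).map_eq

/-- One member of an independent family is independent of all the others together with a seed
that is independent of the whole family. -/
lemma indepFun_seed_others {κ E Ξ : Type*} [MeasurableSpace E] [MeasurableSpace Ξ]
    [IsProbabilityMeasure μ] {X : κ → Ω → E} {W : Ω → Ξ} (hX : ∀ q, Measurable (X q))
    (hW : Measurable W) (hind : iIndepFun X μ) (hWX : IndepFun W (fun ω q => X q ω) μ) (q : κ) :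
    IndepFun (X q) (fun ω => (W ω, fun p : {p // p ≠ q} => X p ω)) μ := by
  refine indepFun_prodMk_of_indepFun (hX q) (by fun_prop) hW ?_ ?_
  · have hle : ∀ i, MeasurableSpace.comap (X i) inferInstance ≤ ‹MeasurableSpace Ω› :=
      fun i => (hX i).comap_le
    have := indep_iSup_of_disjoint hle hind.iIndep (S := {q}) (T := {q}ᶜ)
      disjoint_compl_right
    rw [IndepFun_iff_Indep]
    refine indep_of_indep_of_le_left (indep_of_indep_of_le_right this ?_) ?_
    · rw [← measurable_iff_comap_le]
      refine @measurable_pi_lambda _ _ _ (_) _ _ fun p => ?_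
      rw [measurable_iff_comap_le]
      exact le_iSup₂_of_le p.1 p.2 le_rfl
    · exact le_iSup₂_of_le q rfl le_rfl
  · exact hWX.comp measurable_id
      (ψ := fun f : κ → E => (f q, fun p : {p // p ≠ q} => f p)) (by fun_prop)

end Independence

/-! ### Decision rules run on a table of outputs -/

section History

variable {B E Ξ : Type*} [DecidableEq B]

/-- The number of rounds of a history in which `n` was picked. -/
def pickCount {t : ℕ} (h : Fin t → B × E) (n : B) : ℕ :=
  (Finset.univ.filter fun r => (h r).1 = n).card

/-- The entry of the reward table that is read in the round following a history: the arm picked,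
and the number of its earlier pulls. -/
def nextQuery (rule : (t : ℕ) → Ξ × (Fin t → B × E) → B) (t : ℕ)
    (p : Ξ × (Fin t → B × E)) : B × ℕ :=
  (rule t p, pickCount p.2 (rule t p))

/-- The history of `t` rounds of a decision rule run with seed `ξ` on a reward table `y`, whose entry
`y (n, s)` is the output of the `(s+1)`-st pull of arm `n`. -/
def history (rule : (t : ℕ) → Ξ × (Fin t → B × E) → B) (ξ : Ξ) (y : B × ℕ → E) :
    (t : ℕ) → Fin t → B × E
  | 0 => Fin.elim0
  | t + 1 =>
    let q := nextQuery rule t (ξ, history rule ξ y t)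
    Fin.snoc (α := fun _ => B × E) (history rule ξ y t) (q.1, y q)

lemma pickCount_snoc {t : ℕ} (h : Fin t → B × E) (p : B × E) (n : B) :
    pickCount (Fin.snoc (α := fun _ => B × E) h p) n =
      pickCount h n + if p.1 = n then 1 else 0 := by
  simp only [pickCount, Finset.card_filter, Fin.sum_univ_castSucc, Fin.snoc_castSucc, Fin.snoc_last]

lemma pickCount_le {t : ℕ} (h : Fin t → B × E) (n : B) : pickCount h n ≤ t := by
  simpa [pickCount] using Finset.card_filter_le (Finset.univ : Finset (Fin t)) fun r => (h r).1 = n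

/-- As long as the table entry `q` has not been read, its value has no influence on the history. -/
lemma history_congr (rule : (t : ℕ) → Ξ × (Fin t → B × E) → B) (ξ : Ξ) {y y' : B × ℕ → E}
    {q : B × ℕ} (hy : ∀ p ≠ q, y p = y' p) :
    ∀ t, pickCount (history rule ξ y t) q.1 ≤ q.2 → history rule ξ y t = history rule ξ y' t
  | 0, _ => rfl
  | t + 1, h => by
    rw [history, pickCount_snoc] at h
    have ih := history_congr rule ξ hy t (by omega)
    rw [history, history, ← ih]
    have hne : nextQuery rule t (ξ, history rule ξ y t) ≠ q := by
      intro he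
      have h1 : (nextQuery rule t (ξ, history rule ξ y t)).1 = q.1 := by rw [he]
      have h2 : pickCount (history rule ξ y t) (nextQuery rule t (ξ, history rule ξ y t)).1 =
        q.2 := by rw [← he]; rfl
      rw [if_pos h1] at h
      rw [h1] at h2
      omega
    simp only [hy _ hne]

variable [MeasurableSpace B] [MeasurableSpace E] [MeasurableSpace Ξ] [Countable B]
  [MeasurableSingletonClass B]

lemma measurable_nextQuery {rule : (t : ℕ) → Ξ × (Fin t → B × E) → B}
    (hrule : ∀ t, Measurable (rule t)) (t : ℕ) : Measurable (nextQuery rule t) := by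
  have hc : Measurable fun p : B × (Fin t → B × E) => pickCount p.2 p.1 := by
    refine measurable_from_prod_countable_right fun n => ?_
    simp only [pickCount, Finset.card_filter]
    refine Finset.measurable_sum _ fun r _ => Measurable.ite ?_ measurable_const measurable_const
    exact measurableSet_eq_fun (by fun_prop) measurable_const
  exact (hrule t).prodMk (hc.comp ((hrule t).prodMk measurable_snd))

lemma measurable_history {rule : (t : ℕ) → Ξ × (Fin t → B × E) → B}
    (hrule : ∀ t, Measurable (rule t)) (t : ℕ) :
    Measurable fun p : Ξ × (B × ℕ → E) => history rule p.1 p.2 t := by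
  induction t with
  | zero => exact measurable_pi_lambda _ fun r => r.elim0
  | succ t ih =>
    have hq : Measurable fun p : Ξ × (B × ℕ → E) =>
        nextQuery rule t (p.1, history rule p.1 p.2 t) :=
      (measurable_nextQuery hrule t).comp (measurable_fst.prodMk ih)
    have hev : Measurable fun p : (B × ℕ) × (B × ℕ → E) => p.2 p.1 :=
      measurable_from_prod_countable_right fun q => by fun_prop
    refine measurable_pi_lambda _ fun r => ?_
    refine Fin.lastCases ?_ (fun r => ?_) r
    · simp only [history, Fin.snoc_last]
      exact hq.fst.prodMk (hev.comp (hq.prodMk measurable_snd))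
    · simp only [history, Fin.snoc_castSucc]
      exact (measurable_pi_apply r).comp ih

variable {Ω : Type*} [MeasurableSpace Ω] {μ : Measure Ω}

/-- The table entry that is read next is fresh: a function `Φ` of the seed and the history that
vanishes unless the next query is `q` is independent of the entry `q`. Indeed such a `Φ` does not
change when the entry `q` is overwritten. -/
lemma indepFun_next_query [IsProbabilityMeasure μ] {F : Type*} [MeasurableSpace F] [Zero F]
    [Nonempty E]
    {X : B × ℕ → Ω → E} {W : Ω → Ξ} (hX : ∀ q, Measurable (X q)) (hW : Measurable W)
    (hind : iIndepFun X μ) (hWX : IndepFun W (fun ω q => X q ω) μ)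
    {rule : (t : ℕ) → Ξ × (Fin t → B × E) → B} (hrule : ∀ t, Measurable (rule t)) {t : ℕ}
    {Φ : Ξ × (Fin t → B × E) → F} (hΦ : Measurable Φ) (q : B × ℕ)
    (h0 : ∀ p, nextQuery rule t p ≠ q → Φ p = 0) :
    IndepFun (fun ω => Φ (W ω, history rule (W ω) (fun q => X q ω) t)) (X q) μ := by
  obtain ⟨z⟩ := ‹Nonempty E›
  let fill : ({p : B × ℕ // p ≠ q} → E) → B × ℕ → E :=
    fun f p => if hp : p = q then z else f ⟨p, hp⟩
  have hfill : Measurable fill := by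
    refine measurable_pi_lambda _ fun p => ?_
    by_cases hp : p = q
    · simp only [fill, hp, dite_true]; exact measurable_const
    · simp only [fill, hp, dite_false]; fun_prop
  have heq : ∀ (ξ : Ξ) (y : B × ℕ → E), Φ (ξ, history rule ξ y t) =
      Φ (ξ, history rule ξ (fill fun p => y p) t) := by
    intro ξ y
    have hy : ∀ p ≠ q, y p = fill (fun p => y p) p := fun p hp => by simp [fill, hp]
    have hle : ∀ {p : Ξ × (Fin t → B × E)}, nextQuery rule t p = q →
        pickCount p.2 q.1 ≤ q.2 := fun h => h ▸ le_rfl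
    by_cases h1 : nextQuery rule t (ξ, history rule ξ y t) = q
    · rw [history_congr rule ξ hy t (hle h1)]
    by_cases h2 : nextQuery rule t (ξ, history rule ξ (fill fun p => y p) t) = q
    · rw [history_congr rule ξ (fun p hp => (hy p hp).symm) t (hle h2)]
    · rw [h0 _ h1, h0 _ h2]
  have hm : Measurable fun p : Ξ × ({p : B × ℕ // p ≠ q} → E) =>
      Φ (p.1, history rule p.1 (fill p.2) t) :=
    hΦ.comp (measurable_fst.prodMk
      ((measurable_history hrule t).comp (measurable_fst.prodMk (hfill.comp measurable_snd))))
  have := (indepFun_seed_others hX hW hind hWX q).symm.comp hm measurable_id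
  refine IndepFun.congr this (ae_of_all _ fun ω => ?_) (ae_of_all _ fun ω => rfl)
  exact (heq (W ω) fun q => X q ω).symm

end History

/-! ### The second moment of the sum of the outputs -/

section SecondMoment

variable {B E Ξ Ω : Type*} [DecidableEq B] [Fintype B] [MeasurableSpace B]
  [MeasurableSingletonClass B] [MeasurableSpace Ξ] [MeasurableSpace Ω] {μ : Measure Ω}
  [IsProbabilityMeasure μ]
  [NormedAddCommGroup E] [InnerProductSpace ℝ E] [CompleteSpace E] [MeasurableSpace E]
  [BorelSpace E] [SecondCountableTopology E]

/-- The sum of the centred outputs of a nonanticipating sequence of pulls is a martingale, so its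
second moment is the expected sum of the variances of the arms that were pulled. -/
lemma integral_norm_sq_sum_outputs {X : B × ℕ → Ω → E} {W : Ω → Ξ} (hX : ∀ q, Measurable (X q))
    (hW : Measurable W) (hind : iIndepFun X μ) (hWX : IndepFun W (fun ω q => X q ω) μ)
    {rule : (t : ℕ) → Ξ × (Fin t → B × E) → B} (hrule : ∀ t, Measurable (rule t))
    {pick : ℕ → Ω → B} {G : ℕ → Ω → E}
    (hG : ∀ t ω, history rule (W ω) (fun q => X q ω) t = fun r : Fin t => (pick r ω, G r ω))
    {m : E} {v : B → ℝ} (hL2 : ∀ q, MemLp (X q) 2 μ) (hm : ∀ q, ∫ ω, X q ω ∂μ = m)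
    (hv : ∀ q, ∫ ω, ‖X q ω - m‖ ^ 2 ∂μ = v q.1) (t : ℕ) :
    MemLp (fun ω => ∑ r ∈ Finset.range t, (G r ω - m)) 2 μ ∧
      ∫ ω, ‖∑ r ∈ Finset.range t, (G r ω - m)‖ ^ 2 ∂μ =
        ∫ ω, ∑ r ∈ Finset.range t, v (pick r ω) ∂μ := by
  have hhist : ∀ t, Measurable fun ω => (W ω, history rule (W ω) (fun q => X q ω) t) := fun t =>
    hW.prodMk ((measurable_history hrule t).comp (hW.prodMk (by fun_prop)))
  have hpick : ∀ t, Measurable (pick t) := by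
    intro t
    have h1 : pick t = fun ω =>
        (history rule (W ω) (fun q => X q ω) (t + 1) (Fin.last t)).1 := by
      ext1 ω; rw [hG]; rfl
    rw [h1]
    exact ((measurable_pi_apply (Fin.last t)).comp (hhist (t + 1)).snd).fst
  have hvint : ∀ r, Integrable (fun ω => v (pick r ω)) μ := fun r =>
    (Integrable.of_finite (μ := μ.map (pick r)) (f := v)).comp_measurable (hpick r)
  induction t with
  | zero => simp
  | succ t ih =>
    obtain ⟨ihL, ihe⟩ := ih
    set D : Ω → E := fun ω => ∑ r ∈ Finset.range t, (G r ω - m) with hD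
    set nq : Ω → B × ℕ :=
      fun ω => nextQuery rule t (W ω, history rule (W ω) (fun q => X q ω) t) with hnq
    have hnqm : Measurable nq := (measurable_nextQuery hrule t).comp (hhist t)
    have hstep : ∀ ω, pick t ω = (nq ω).1 ∧ G t ω = X (nq ω) ω := by
      intro ω
      have := congrFun (hG (t + 1) ω) (Fin.last t)
      rw [history] at this
      simp only [Fin.snoc_last, Fin.val_last, Prod.mk.injEq] at this
      exact ⟨this.1.symm, this.2.symm⟩
    -- the table entries that can be read in this round
    set Q : Finset (B × ℕ) := Finset.univ ×ˢ Finset.range (t + 1) with hQ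
    have hmemQ : ∀ ω, nq ω ∈ Q := by
      intro ω
      rw [hQ, Finset.mem_product, Finset.mem_range, Nat.lt_succ_iff]
      exact ⟨Finset.mem_univ _, pickCount_le _ _⟩
    have hAm : ∀ q, MeasurableSet {ω | nq ω = q} := fun q => hnqm (measurableSet_singleton q)
    have hXm : ∀ q, MemLp (fun ω => X q ω - m) 2 μ := fun q => (hL2 q).sub (memLp_const m)
    have hdec : ∀ (H : B × ℕ → Ω → ℝ) (ω : Ω),
        H (nq ω) ω = ∑ q ∈ Q, Set.indicator {ω | nq ω = q} (H q) ω := by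
      intro H ω
      simp only [Set.indicator_apply, Set.mem_ofPred_eq]
      rw [Finset.sum_ite_eq, if_pos (hmemQ ω)]
    have hξL : MemLp (fun ω => G t ω - m) 2 μ := by
      have : (fun ω => G t ω - m) =
          fun ω => ∑ q ∈ Q, Set.indicator {ω | nq ω = q} (fun ω => X q ω - m) ω := by
        ext1 ω
        simp only [Set.indicator_apply, Set.mem_ofPred_eq]
        rw [Finset.sum_ite_eq, if_pos (hmemQ ω), (hstep ω).2]
      rw [this]
      exact memLp_finsetSum _ fun q _ => (hXm q).indicator (hAm q)
    -- the cross term vanishes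
    have hcross : ∫ ω, inner ℝ (D ω) (G t ω - m) ∂μ = 0 := by
      have hpt : ∀ ω, inner ℝ (D ω) (G t ω - m) =
          ∑ q ∈ Q, innerSL ℝ (Set.indicator {ω | nq ω = q} D ω) (X q ω - m) := by
        intro ω
        rw [(hstep ω).2, hdec (fun q ω => inner ℝ (D ω) (X q ω - m)) ω]
        refine Finset.sum_congr rfl fun q _ => ?_
        by_cases h : nq ω = q <;> simp [h]
      have hDint : ∀ q, Integrable (Set.indicator {ω | nq ω = q} D) μ := fun q =>
        (ihL.integrable one_le_two).indicator (hAm q)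
      have hindq : ∀ q, IndepFun (Set.indicator {ω | nq ω = q} D) (fun ω => X q ω - m) μ := by
        intro q
        classical
        have hΦ : Measurable fun p : Ξ × (Fin t → B × E) =>
            if nextQuery rule t p = q then ∑ r, ((p.2 r).2 - m) else 0 :=
          Measurable.ite (measurable_nextQuery hrule t (measurableSet_singleton q))
            (by fun_prop) measurable_const
        have := indepFun_next_query hX hW hind hWX hrule hΦ q (fun p hp => if_neg hp)
        have := this.comp measurable_id (ψ := fun x : E => x - m) (by fun_prop)
        refine IndepFun.congr this (ae_of_all _ fun ω => ?_) (ae_of_all _ fun ω => rfl)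
        simp only [Function.comp, id, Set.indicator_apply, Set.mem_ofPred_eq, hnq, hD]
        have hs : ∑ r, ((history rule (W ω) (fun q => X q ω) t r).2 - m) =
            ∑ r ∈ Finset.range t, (G r ω - m) := by
          rw [hG t ω, ← Finset.sum_range fun r => G r ω - m]
        rw [hs]
      rw [integral_congr_ae (ae_of_all _ hpt), integral_finsetSum _ fun q _ =>
        (hindq q).integrable_bilin (hDint q) ((hXm q).integrable one_le_two) (innerSL ℝ)]
      refine Finset.sum_eq_zero fun q _ => ?_
      rw [(hindq q).integral_bilin (hDint q) ((hXm q).integrable one_le_two) (innerSL ℝ),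
        integral_sub ((hL2 q).integrable one_le_two) (integrable_const _), hm]
      simp
    -- the diagonal term
    have hdiag : ∫ ω, ‖G t ω - m‖ ^ 2 ∂μ = ∫ ω, v (pick t ω) ∂μ := by
      have hpt : ∀ ω, ‖G t ω - m‖ ^ 2 =
          ∑ q ∈ Q, Set.indicator {ω | nq ω = q} (fun _ => (1 : ℝ)) ω * ‖X q ω - m‖ ^ 2 := by
        intro ω
        rw [(hstep ω).2, hdec (fun q ω => ‖X q ω - m‖ ^ 2) ω]
        refine Finset.sum_congr rfl fun q _ => ?_
        by_cases h : nq ω = q <;> simp [h]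
      have hpt' : ∀ ω, v (pick t ω) =
          ∑ q ∈ Q, Set.indicator {ω | nq ω = q} (fun _ => (1 : ℝ)) ω * v q.1 := by
        intro ω
        rw [(hstep ω).1, hdec (fun q _ => v q.1) ω]
        refine Finset.sum_congr rfl fun q _ => ?_
        by_cases h : nq ω = q <;> simp [h]
      have hA1 : ∀ q, Integrable (Set.indicator {ω | nq ω = q} (fun _ => (1 : ℝ))) μ := fun q =>
        (integrable_const _).indicator (hAm q)
      have hindq : ∀ q, IndepFun (Set.indicator {ω | nq ω = q} (fun _ => (1 : ℝ)))
          (fun ω => ‖X q ω - m‖ ^ 2) μ := by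
        intro q
        classical
        have hΦ : Measurable fun p : Ξ × (Fin t → B × E) =>
            if nextQuery rule t p = q then (1 : ℝ) else 0 :=
          Measurable.ite (measurable_nextQuery hrule t (measurableSet_singleton q))
            measurable_const measurable_const
        have := indepFun_next_query hX hW hind hWX hrule hΦ q (fun p hp => if_neg hp)
        have := this.comp measurable_id (ψ := fun x : E => ‖x - m‖ ^ 2) (by fun_prop)
        refine IndepFun.congr this (ae_of_all _ fun ω => ?_) (ae_of_all _ fun ω => rfl)
        simp only [Function.comp, id, Set.indicator_apply, Set.mem_ofPred_eq, hnq]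
      have hsq : ∀ q, Integrable (fun ω => ‖X q ω - m‖ ^ 2) μ := fun q =>
        (hXm q).integrable_norm_pow two_ne_zero
      have hAX : ∀ q, Integrable (fun ω =>
          Set.indicator {ω | nq ω = q} (fun _ => (1 : ℝ)) ω * ‖X q ω - m‖ ^ 2) μ := fun q =>
        (hindq q).integrable_mul (hA1 q) (hsq q)
      rw [integral_congr_ae (ae_of_all _ hpt), integral_congr_ae (ae_of_all _ hpt'),
        integral_finsetSum _ fun q _ => hAX q,
        integral_finsetSum _ fun q _ => (hA1 q).mul_const _]
      refine Finset.sum_congr rfl fun q _ => ?_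
      rw [(hindq q).integral_fun_mul_eq_mul_integral (hA1 q).1 (hsq q).1, hv,
        integral_mul_const]
    have hsplit : (fun ω => ∑ r ∈ Finset.range (t + 1), (G r ω - m)) =
        fun ω => D ω + (G t ω - m) := by
      ext1 ω; rw [Finset.sum_range_succ]
    refine ⟨by rw [hsplit]; exact ihL.add hξL, ?_⟩
    have hI1 : Integrable (fun ω => ‖D ω‖ ^ 2) μ := ihL.integrable_norm_pow two_ne_zero
    have hI2 : Integrable (fun ω => 2 * inner ℝ (D ω) (G t ω - m)) μ := by
      refine Integrable.const_mul ((ihL.norm.integrable_mul hξL.norm).mono'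
        (ihL.1.inner hξL.1) (ae_of_all _ fun ω => ?_)) 2
      exact norm_inner_le_norm _ _
    have hI3 : Integrable (fun ω => ‖G t ω - m‖ ^ 2) μ := hξL.integrable_norm_pow two_ne_zero
    calc ∫ ω, ‖∑ r ∈ Finset.range (t + 1), (G r ω - m)‖ ^ 2 ∂μ
        = ∫ ω, (‖D ω‖ ^ 2 + 2 * inner ℝ (D ω) (G t ω - m) + ‖G t ω - m‖ ^ 2) ∂μ := by
          refine integral_congr_ae (ae_of_all _ fun ω => ?_)
          simp only
          rw [congrFun hsplit ω, norm_add_sq_real]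
      _ = ∫ ω, ‖D ω‖ ^ 2 ∂μ + ∫ ω, ‖G t ω - m‖ ^ 2 ∂μ := by
          rw [integral_add (f := fun ω => ‖D ω‖ ^ 2 + 2 * inner ℝ (D ω) (G t ω - m))
              (hI1.add hI2) hI3,
            integral_add hI1 hI2, integral_const_mul, hcross]
          simp
      _ = ∫ ω, ∑ r ∈ Finset.range (t + 1), v (pick r ω) ∂μ := by
          rw [ihe, hdiag, ← integral_add (integrable_finsetSum _ fun r _ => hvint r) (hvint t)]
          simp_rw [Finset.sum_range_succ]

end SecondMoment

/-! ### The mini-batch oracle and its sample covariance -/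

section Oracle

variable {Ω : Type*} {d N : ℕ}
  {M : Matrix (Fin d) (Fin d) ℝ} {θ : BatchSize N → ℝ} {g : EuclideanSpace ℝ (Fin d)}
  {U : NoiseIndex N → Ω → EuclideanSpace ℝ (Fin d)}

lemma batchSize_pos (n : BatchSize N) : 0 < (n : ℕ) := (Finset.mem_Icc.mp n.2).1

lemma oracle_sub_apply (n : BatchSize N) (s : ℕ) (ω : Ω) (i : Fin d) :
    oracle g U n s ω i - g i = (1 / ((n : ℕ) : ℝ)) * ∑ j : Fin (n : ℕ), U ⟨n, s, j⟩ ω i := by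
  have hn : ((n : ℕ) : ℝ) ≠ 0 := by exact_mod_cast (batchSize_pos n).ne'
  simp only [oracle, PiLp.smul_apply, WithLp.ofLp_sum, Finset.sum_apply, PiLp.add_apply,
    smul_eq_mul, Finset.sum_add_distrib, Finset.sum_const, Finset.card_univ, Fintype.card_fin,
    nsmul_eq_mul]
  field_simp
  ring

lemma sampleCov_trace_eq (n : BatchSize N) {k : ℕ} (hk : 2 ≤ k) (ω : Ω) :
    (sampleCov g U n k ω).trace = 1 / ((k : ℝ) - 1) *
      ∑ i, (∑ s ∈ Finset.range k, (oracle g U n s ω i - g i) ^ 2 -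
        (∑ s ∈ Finset.range k, (oracle g U n s ω i - g i)) ^ 2 / k) := by
  have hk0 : (k : ℝ) ≠ 0 := by positivity
  rw [sampleCov, Matrix.trace_smul, smul_eq_mul, Matrix.trace_sum]
  simp only [Matrix.trace_vecMulVec, dotProduct]
  rw [Finset.sum_comm]
  congr 1
  refine Finset.sum_congr rfl fun i _ => ?_
  set x : ℕ → ℝ := fun s => oracle g U n s ω i - g i with hx
  have hmean : sampleMean g U n k ω i = g i + (∑ s ∈ Finset.range k, x s) / k := by
    simp only [sampleMean, PiLp.smul_apply, WithLp.ofLp_sum, Finset.sum_apply, smul_eq_mul, hx,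
      Finset.sum_sub_distrib, Finset.sum_const, Finset.card_range, nsmul_eq_mul]
    field_simp
    ring
  have hterm : ∀ s, (oracle g U n s ω i - sampleMean g U n k ω i) *
      (oracle g U n s ω i - sampleMean g U n k ω i) =
      x s ^ 2 - 2 * ((∑ s ∈ Finset.range k, x s) / k) * x s +
        ((∑ s ∈ Finset.range k, x s) / k) ^ 2 := by
    intro s
    rw [hmean, show oracle g U n s ω i = x s + g i by simp [hx]]
    ring
  simp_rw [hterm]
  rw [Finset.sum_add_distrib, Finset.sum_sub_distrib, ← Finset.mul_sum, Finset.sum_const,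
    Finset.card_range, nsmul_eq_mul]
  field_simp
  ring

variable [MeasurableSpace Ω] {μ : Measure Ω}

lemma measurable_oracle (hU : ∀ i, Measurable (U i)) (n : BatchSize N) (s : ℕ) :
    Measurable (oracle g U n s) := by
  unfold oracle
  fun_prop

lemma iIndepFun_oracle (hU : ∀ i, Measurable (U i)) (hind : iIndepFun U μ) :
    iIndepFun (fun q : BatchSize N × ℕ => oracle g U q.1 q.2) μ := by
  let e : ((q : BatchSize N × ℕ) × Fin (q.1 : ℕ)) → NoiseIndex N := fun p => ⟨p.1.1, p.1.2, p.2⟩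
  have he : Function.Injective e := by
    rintro ⟨⟨n, s⟩, j⟩ ⟨⟨n', s'⟩, j'⟩ h
    simp only [e, Sigma.mk.injEq] at h
    obtain ⟨rfl, h⟩ := h
    simp only [heq_eq_eq, Prod.mk.injEq] at h
    obtain ⟨rfl, rfl⟩ := h
    rfl
  have hb := iIndepFun_blocks (X := fun p => U (e p)) (fun p => hU _) (hind.precomp he)
  exact hb.comp
    (fun (q : BatchSize N × ℕ) (f : Fin (q.1 : ℕ) → EuclideanSpace ℝ (Fin d)) =>
      (1 / ((q.1 : ℕ) : ℝ)) • ∑ j, (g + f j)) (fun q => by fun_prop)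

lemma indepFun_seed_oracle {Ξ : Type*} [MeasurableSpace Ξ] {seed : Ω → Ξ}
    (h : IndepFun seed (fun ω i => U i ω) μ) :
    IndepFun seed (fun ω (q : BatchSize N × ℕ) => oracle g U q.1 q.2 ω) μ :=
  h.comp measurable_id
    (ψ := fun (f : NoiseIndex N → EuclideanSpace ℝ (Fin d)) (q : BatchSize N × ℕ) =>
      (1 / ((q.1 : ℕ) : ℝ)) • ∑ j : Fin (q.1 : ℕ), (g + f ⟨q.1, q.2, j⟩)) (by fun_prop)

lemma integral_oracle_sub (hU : ∀ i, IsGradientNoise μ M (θ i.1) (U i))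
    (n : BatchSize N) (s : ℕ) (i : Fin d) :
    ∫ ω, (oracle g U n s ω i - g i) ∂μ = 0 := by
  simp_rw [oracle_sub_apply]
  rw [integral_const_mul, integral_finsetSum _ fun j _ => ((hU _).subGaussian i).integrable]
  simp [(hU _).mean_zero]

lemma hasSubgaussianMGF_oracle_sub (hU : ∀ i, IsGradientNoise μ M (θ i.1) (U i))
    (hind : iIndepFun U μ) (n : BatchSize N) (s : ℕ) (i : Fin d) (hθ : 0 < θ n)
    (hM : 0 < M i i) :
    HasSubgaussianMGF (fun ω => oracle g U n s ω i - g i)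
      (Real.toNNReal (1 / ((n : ℕ) * θ n) * M i i)) μ := by
  have hn : (0 : ℝ) < (n : ℕ) := by exact_mod_cast batchSize_pos n
  have hinj : Function.Injective fun j : Fin (n : ℕ) => (⟨n, s, j⟩ : NoiseIndex N) := by
    intro j j' h
    simpa using h
  have hi : iIndepFun (fun (j : Fin (n : ℕ)) ω => U ⟨n, s, j⟩ ω i) μ :=
    (hind.precomp hinj).comp (fun _ (x : EuclideanSpace ℝ (Fin d)) => x i) fun _ => by fun_prop
  have := (HasSubgaussianMGF.sum_of_iIndepFun hi (s := Finset.univ)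
    (c := fun _ => Real.toNNReal ((θ n)⁻¹ * M i i))
    (fun j _ => (hU ⟨n, s, j⟩).subGaussian i)).const_mul (1 / ((n : ℕ) : ℝ))
  simp_rw [oracle_sub_apply]
  convert! this using 1
  rw [Finset.sum_const, Finset.card_univ, Fintype.card_fin, nsmul_eq_mul]
  refine NNReal.eq ?_
  change _ = (1 / ((n : ℕ) : ℝ)) ^ 2 * (((n : ℕ) : ℝ) * (Real.toNNReal ((θ n)⁻¹ * M i i) : ℝ))
  rw [Real.coe_toNNReal _ (by positivity), Real.coe_toNNReal _ (by positivity)]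
  field_simp

lemma integral_oracle_sub_sq [IsProbabilityMeasure μ]
    (hU : ∀ i, IsGradientNoise μ M (θ i.1) (U i)) (hind : iIndepFun U μ)
    (n : BatchSize N) (s : ℕ) (i : Fin d) :
    ∫ ω, (oracle g U n s ω i - g i) ^ 2 ∂μ = 1 / ((n : ℕ) * θ n) * M i i := by
  have hn : (0 : ℝ) < (n : ℕ) := by exact_mod_cast batchSize_pos n
  have hL2 : ∀ p : NoiseIndex N, MemLp (fun ω => U p ω i) 2 μ := fun p =>
    ((hU p).subGaussian i).memLp 2
  have hm : ∀ p, Measurable fun ω => U p ω i := fun p => by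
    have := (hU p).measurable
    fun_prop
  have hvar : variance (fun ω => ∑ j : Fin (n : ℕ), U ⟨n, s, j⟩ ω i) μ =
      (n : ℕ) * ((θ n)⁻¹ * M i i) := by
    have hpair : Set.Pairwise ↑(Finset.univ : Finset (Fin (n : ℕ)))
        fun j j' => IndepFun (fun ω => U ⟨n, s, j⟩ ω i) (fun ω => U ⟨n, s, j'⟩ ω i) μ := by
      intro j _ j' _ hjj
      have : (⟨n, s, j⟩ : NoiseIndex N) ≠ ⟨n, s, j'⟩ := by simpa using hjj
      exact (hind.indepFun this).comp (φ := fun x : EuclideanSpace ℝ (Fin d) => x i)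
        (ψ := fun x : EuclideanSpace ℝ (Fin d) => x i) (by fun_prop) (by fun_prop)
    have := IndepFun.variance_sum (s := Finset.univ)
      (X := fun (j : Fin (n : ℕ)) ω => U ⟨n, s, j⟩ ω i) (fun j _ => hL2 _) hpair
    rw [show (fun ω => ∑ j : Fin (n : ℕ), U ⟨n, s, j⟩ ω i) =
      ∑ j : Fin (n : ℕ), fun ω => U ⟨n, s, j⟩ ω i by ext ω; simp, this]
    rw [Finset.sum_congr rfl (g := fun _ => (θ n)⁻¹ * M i i)]
    · simp
    · intro j _
      rw [variance_of_integral_eq_zero (hm _).aemeasurable ((hU _).mean_zero i)]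
      simp_rw [sq]
      exact (hU ⟨n, s, j⟩).covariance i i
  rw [variance_of_integral_eq_zero
    (Finset.measurable_sum _ fun j _ => hm _).aemeasurable] at hvar
  · simp_rw [oracle_sub_apply, mul_pow]
    rw [integral_const_mul, hvar]
    field_simp
  · rw [integral_finsetSum _ fun j _ => (hL2 _).integrable one_le_two]
    simp [(hU _).mean_zero]

lemma memLp_oracle_apply_sub (hU : ∀ i, IsGradientNoise μ M (θ i.1) (U i))
    (n : BatchSize N) (s : ℕ) (i : Fin d) :
    MemLp (fun ω => oracle g U n s ω i - g i) 2 μ := by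
  simp_rw [oracle_sub_apply]
  exact (memLp_finsetSum _ fun j _ => ((hU _).subGaussian i).memLp 2).const_mul _

/-- Second-order description of the oracle with mini-batch size `n`: it is square integrable with
mean the true gradient and total variance `σ_n² tr M`. -/
lemma oracle_moments [IsProbabilityMeasure μ]
    (hU : ∀ i, IsGradientNoise μ M (θ i.1) (U i)) (hind : iIndepFun U μ)
    (n : BatchSize N) (s : ℕ) :
    MemLp (oracle g U n s) 2 μ ∧ ∫ ω, oracle g U n s ω ∂μ = g ∧
      ∫ ω, ‖oracle g U n s ω - g‖ ^ 2 ∂μ = 1 / ((n : ℕ) * θ n) * M.trace := by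
  have hm : Measurable (oracle g U n s) := measurable_oracle (fun i => (hU i).measurable) n s
  have hcoord : ∀ i, MemLp (fun ω => oracle g U n s ω i - g i) 2 μ :=
    fun i => memLp_oracle_apply_sub hU n s i
  have hnorm : ∀ ω, ‖oracle g U n s ω - g‖ ^ 2 = ∑ i, (oracle g U n s ω i - g i) ^ 2 := by
    intro ω
    rw [EuclideanSpace.real_norm_sq_eq]
    simp
  have hLp : MemLp (oracle g U n s) 2 μ := by
    have : MemLp (fun ω => oracle g U n s ω - g) 2 μ := by
      rw [memLp_two_iff_integrable_sq_norm (hm.sub_const g).aestronglyMeasurable]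
      simp_rw [hnorm]
      exact integrable_finsetSum _ fun i _ => (hcoord i).integrable_sq
    simpa [Pi.add_def] using this.add (memLp_const g)
  refine ⟨hLp, ?_, ?_⟩
  · ext i
    have h1 := (EuclideanSpace.proj (𝕜 := ℝ) i).integral_comp_comm (hLp.integrable one_le_two)
    have h2 := integral_oracle_sub (g := g) hU n s i
    have hint : Integrable (fun ω => oracle g U n s ω i) μ := by
      simpa [Pi.add_def] using ((hcoord i).integrable one_le_two).add (integrable_const (g i))
    rw [integral_sub hint (integrable_const _)] at h2
    simp only [PiLp.proj_apply, EuclideanSpace.proj] at h1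
    rw [← h1]
    simp at h2
    linarith
  · simp_rw [hnorm]
    rw [integral_finsetSum _ fun i _ => (hcoord i).integrable_sq, Matrix.trace, Finset.mul_sum]
    exact Finset.sum_congr rfl fun i _ => integral_oracle_sub_sq hU hind n s i

lemma measurable_sampleCov_trace (hU : ∀ i, Measurable (U i)) (n : BatchSize N) {k : ℕ}
    (hk : 2 ≤ k) : Measurable fun ω => (sampleCov g U n k ω).trace := by
  simp_rw [sampleCov_trace_eq (g := g) (U := U) n hk]
  have := fun s => measurable_oracle (g := g) hU n s
  fun_prop

/-- Both tails of the trace of the sample covariance matrix of `k` outputs of the oracle with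
mini-batch size `n`, around its mean `σ_n² tr M`. -/
lemma sampleCov_trace_tail [IsProbabilityMeasure μ]
    (hU : ∀ i, IsGradientNoise μ M (θ i.1) (U i)) (hind : iIndepFun U μ)
    (n : BatchSize N) (hd : 0 < d)
    (hθ : 0 < θ n) (hM : ∀ i, 0 < M i i) {β P : ℝ} (hβ : 1 / ((n : ℕ) * θ n) ≤ β)
    (hP : M.trace ≤ P) {k : ℕ} (hk : 2 ≤ k) {ε : ℝ} (hε : 0 ≤ ε) :
    μ.real {ω | 1 / ((n : ℕ) * θ n) * M.trace + ε ≤ (sampleCov g U n k ω).trace} ≤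
        Real.exp (-(((k : ℝ) - 1) * phi (1 / 16384) β P d ε)) ∧
      μ.real {ω | (sampleCov g U n k ω).trace ≤ 1 / ((n : ℕ) * θ n) * M.trace - ε} ≤
        Real.exp (-(((k : ℝ) - 1) * phi (1 / 16384) β P d ε)) := by
  have hn : (0 : ℝ) < (n : ℕ) := by exact_mod_cast batchSize_pos n
  have hk1 : (0 : ℝ) < (k : ℝ) - 1 := by
    have : (2 : ℝ) ≤ k := by exact_mod_cast hk
    linarith
  have hd1 : (1 : ℝ) ≤ d := by exact_mod_cast hd
  set σ : ℝ := 1 / ((n : ℕ) * θ n) with hσ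
  have hσ0 : 0 < σ := by positivity
  have hS : 0 < M.trace := by
    have : Nonempty (Fin d) := ⟨⟨0, hd⟩⟩
    exact Finset.sum_pos (fun i _ => hM i) Finset.univ_nonempty
  have hV : 0 < σ * M.trace := by positivity
  have hVb : σ * M.trace ≤ β * P := by gcongr; exact hσ0.le.trans hβ
  have hb : 0 < β * P := hV.trans_le hVb
  have hmU : ∀ i, Measurable (U i) := fun i => (hU i).measurable
  have hmo := fun s => measurable_oracle (g := g) hmU n s
  set q : Fin d → Ω → ℝ := fun i ω => (∑ s ∈ Finset.range k, (oracle g U n s ω i - g i) ^ 2 -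
    (∑ s ∈ Finset.range k, (oracle g U n s ω i - g i)) ^ 2 / k) - ((k : ℝ) - 1) * (σ * M i i)
    with hq
  have hqm : ∀ i, Measurable (q i) := fun i => by fun_prop
  have hcoord : ∀ i, ∀ l, |l| * (σ * M i i) ≤ 1 / 16 →
      Integrable (fun ω => Real.exp (l * q i ω)) μ ∧
      ∫ ω, Real.exp (l * q i ω) ∂μ ≤
        Real.exp (4096 * ((k : ℝ) - 1) * (l * (σ * M i i)) ^ 2) := by
    intro i l hl
    have hinj : Function.Injective fun s : ℕ => (n, s) := fun _ _ h => (Prod.mk.inj h).2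
    have hindx : iIndepFun (fun s ω => oracle g U n s ω i - g i) μ :=
      ((iIndepFun_oracle (g := g) hmU hind).precomp hinj).comp
        (fun _ (x : EuclideanSpace ℝ (Fin d)) => x i - g i) fun _ => by fun_prop
    have := mgf_sum_sq_dev_le (v := σ * M i i) (mul_pos hσ0 (hM i)) (fun s => by fun_prop) hindx
      (fun s => hasSubgaussianMGF_oracle_sub hU hind n s i hθ (hM i))
      (fun s => integral_oracle_sub hU n s i)
      (fun s => integral_oracle_sub_sq hU hind n s i) hk hl
    refine ⟨this.1, this.2.trans_eq ?_⟩
    congr 1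
    ring
  have hY := fun l hl => mgf_sum_coord_le (μ := μ) (q := q) (v := fun i => σ * M i i)
    (V := σ * M.trace) (a := 1 / 16) (C := 4096 * ((k : ℝ) - 1)) (l := l)
    (fun i => mul_pos hσ0 (hM i)) hV
    (by rw [Matrix.trace, Finset.mul_sum]; rfl) hqm hcoord hl
  have htail := tail_le_of_mgf_le (Y := fun ω => ∑ i, q i ω) (m := (k : ℝ) - 1)
    (y := ε / (β * P)) hV hVb hk1.le (by positivity) hY
  have hby : β * P * (ε / (β * P)) = ε := mul_div_cancel₀ ε hb.ne'
  have hsumq : ∀ ω, ∑ i, q i ω = ((k : ℝ) - 1) *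
      ((sampleCov g U n k ω).trace - σ * M.trace) := by
    intro ω
    rw [sampleCov_trace_eq n hk, mul_sub, ← mul_assoc, mul_one_div_cancel hk1.ne', one_mul]
    simp only [hq, Finset.sum_sub_distrib, Matrix.trace, Finset.mul_sum, Matrix.diag_apply]
  -- Jensen's inequality gives a rate without the factor `1 / d` in the definition of `φ`
  have hphi : phi (1 / 16384) β P d ε ≤
      1 / 16384 * (ε / (β * P) * min 1 (ε / (β * P))) := by
    have : ε / d / (β * P) ≤ ε / (β * P) := by
      gcongr
      exact div_le_self hε hd1
    calc phi (1 / 16384) β P d ε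
        = 1 / 16384 * (ε / (β * P) * min 1 (ε / d / (β * P))) := by rw [phi]; ring
      _ ≤ _ := by gcongr
  have hexp : Real.exp (-(((k : ℝ) - 1) *
      (1 / 16384 * (ε / (β * P) * min 1 (ε / (β * P)))))) ≤
      Real.exp (-(((k : ℝ) - 1) * phi (1 / 16384) β P d ε)) := by gcongr
  rw [hby] at htail
  constructor
  · refine le_trans (le_of_eq ?_) (htail.1.trans hexp)
    congr 1
    ext ω
    simp only [Set.mem_ofPred_eq]
    rw [hsumq, mul_le_mul_iff_right₀ hk1]
    constructor <;> intro h <;> linarith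
  · refine le_trans (le_of_eq ?_) (htail.2.trans hexp)
    congr 1
    ext ω
    simp only [Set.mem_ofPred_eq]
    rw [hsumq, ← mul_neg, mul_le_mul_iff_right₀ hk1]
    constructor <;> intro h <;> linarith

end Oracle

/-! ### The number of pulls of suboptimal sizes -/

section Bandit

lemma CostModel.fidelity_pos (K : CostModel) (n : BatchSize K.N) : 0 < K.fidelity n :=
  Function.invFunOn_mem (K.attained n n.2)

lemma CostModel.sigmaSq_pos (K : CostModel) (n : BatchSize K.N) : 0 < K.sigmaSq n := by
  have := K.fidelity_pos n
  have hn : (0 : ℝ) < (n : ℕ) := by exact_mod_cast batchSize_pos n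
  rw [CostModel.sigmaSq]
  positivity

/-- The exploration bonus is the inverse of the rate function `φ`. -/
lemma phi_bonus {c β P x : ℝ} {d : ℕ} (hc : 0 < c) (hb : 0 < β * P) (hd : 0 < d) (hx : 0 ≤ x) :
    phi c β P d (bonus c β P d x) = x := by
  have hd' : (0 : ℝ) < d := by exact_mod_cast hd
  set y : ℝ := √(x * d / c) * max 1 √(x / (c * d)) with hy
  have h1 : phi c β P d (bonus c β P d x) = c * y * min 1 (y / d) := by
    rw [phi, show bonus c β P d x = β * P * y by rw [bonus, hy]; ring]
    have e1 : c * (β * P * y) / (β * P) = c * y := by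
      rw [mul_left_comm, mul_div_cancel_left₀ _ hb.ne']
    have e2 : β * P * y / d / (β * P) = y / d := by
      rw [mul_div_assoc, mul_div_cancel_left₀ _ hb.ne']
    rw [e1, e2]
  have hsq : √(x * d / c) = d * √(x / (c * d)) := by
    rw [show x * d / c = d ^ 2 * (x / (c * d)) by field_simp, Real.sqrt_mul (by positivity),
      Real.sqrt_sq hd'.le]
  set r : ℝ := √(x / (c * d)) with hr
  have hr0 : 0 ≤ r := Real.sqrt_nonneg _
  have hr2 : r ^ 2 = x / (c * d) := Real.sq_sqrt (by positivity)
  have hx' : x = c * d * r ^ 2 := by rw [hr2]; field_simp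
  have hyr : y = d * r * max 1 r := by rw [hy, hsq]
  have hyd : y / d = r * max 1 r := by rw [hyr]; field_simp
  rw [h1, hyd, hyr, hx']
  rcases le_total r 1 with h | h
  · rw [max_eq_left h, mul_one, mul_one, min_eq_right h]; ring
  · rw [max_eq_right h, min_eq_left (by nlinarith)]; ring

lemma phi_mono {c β P a b : ℝ} {d : ℕ} (hc : 0 < c) (hb : 0 < β * P) (ha : 0 ≤ a) (hab : a ≤ b) :
    phi c β P d a ≤ phi c β P d b := by
  unfold phi
  have : 0 ≤ b := ha.trans hab
  gcongr

lemma bonus_nonneg {c β P : ℝ} (hb : 0 < β * P) (d : ℕ) (x : ℝ) : 0 ≤ bonus c β P d x := by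
  unfold bonus
  positivity

lemma phi_pos {c β P ε : ℝ} {d : ℕ} (hc : 0 < c) (hb : 0 < β * P) (hd : 0 < d) (hε : 0 < ε) :
    0 < phi c β P d ε := by
  have hd' : (0 : ℝ) < d := by exact_mod_cast hd
  unfold phi
  have : 0 < min 1 (ε / d / (β * P)) := lt_min one_pos (by positivity)
  positivity

lemma sum_rpow_one_sub_le {α : ℝ} (hα : 2 < α) {a T : ℕ} (ha : 1 ≤ a) :
    ∑ t ∈ Finset.Ico a T, 2 * ((t : ℝ) + 1) ^ (1 - α) ≤ 2 / (α - 2) := by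
  rw [← Finset.mul_sum, div_eq_mul_one_div]
  refine mul_le_mul_of_nonneg_left ?_ two_pos.le
  rcases lt_or_ge T 1 with hT | hT
  · rw [Finset.Ico_eq_empty_of_le (by omega), Finset.sum_empty]
    exact div_nonneg zero_le_one (by linarith)
  have hsub : ∑ t ∈ Finset.Ico a T, ((t : ℝ) + 1) ^ (1 - α) ≤
      ∑ t ∈ Finset.Ico 1 T, ((t : ℝ) + 1) ^ (1 - α) :=
    Finset.sum_le_sum_of_subset_of_nonneg (Finset.Ico_subset_Ico_left ha)
      fun t _ _ => by positivity
  have hanti : AntitoneOn (fun x : ℝ => x ^ (1 - α)) (Set.Icc (1 : ℕ) T) := by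
    intro x hx y hy hxy
    have : (0 : ℝ) < x := lt_of_lt_of_le (by norm_num) hx.1
    exact Real.rpow_le_rpow_of_nonpos this hxy (by linarith)
  have hint := hanti.sum_le_integral_Ico hT
  have hT' : (1 : ℝ) ≤ T := by exact_mod_cast hT
  have hnot : (0 : ℝ) ∉ Set.uIcc (((1 : ℕ) : ℝ)) T := by
    rw [Nat.cast_one, Set.uIcc_of_le hT']
    intro h
    linarith [h.1]
  rw [integral_rpow (Or.inr ⟨by linarith, hnot⟩)] at hint
  push_cast at hint
  rw [Real.one_rpow] at hint
  refine hsub.trans (hint.trans ?_)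
  have hp : 0 ≤ (T : ℝ) ^ (1 - α + 1) := by positivity
  rw [← neg_div_neg_eq, show -(1 - α + 1) = α - 2 by ring]
  gcongr
  linarith

section Pulls

variable {Ω Ξ : Type*} {d N : ℕ} {g : EuclideanSpace ℝ (Fin d)}
  {U : NoiseIndex N → Ω → EuclideanSpace ℝ (Fin d)} {pick : ℕ → Ω → BatchSize N}

lemma pulls_succ (t : ℕ) (n : BatchSize N) (ω : Ω) :
    pulls pick (t + 1) n ω = pulls pick t n ω + if pick t ω = n then 1 else 0 := by
  simp only [pulls, Finset.card_filter, Finset.sum_range_succ]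

lemma pulls_mono (n : BatchSize N) (ω : Ω) : Monotone fun t => pulls pick t n ω :=
  fun _ _ h => Finset.card_le_card (Finset.filter_subset_filter _ (Finset.range_mono h))

lemma pulls_le (t : ℕ) (n : BatchSize N) (ω : Ω) : pulls pick t n ω ≤ t := by
  simpa [pulls] using Finset.card_filter_le (Finset.range t) fun r => pick r ω = n

/-- The observed history of a nonanticipating run is the history of its decision rule on the table
of oracle outputs. -/
lemma history_eq_of_nonanticipating {seed : Ω → Ξ}
    {rule : (t : ℕ) → Ξ × (Fin t → BatchSize N × EuclideanSpace ℝ (Fin d)) → BatchSize N}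
    (h : ∀ t ω, pick t ω =
      rule t (seed ω, fun r : Fin t => (pick r ω, roundOutput g U pick r ω))) (t : ℕ) (ω : Ω) :
    history rule (seed ω) (fun q : BatchSize N × ℕ => oracle g U q.1 q.2 ω) t =
      fun r : Fin t => (pick r ω, roundOutput g U pick r ω) := by
  induction t with
  | zero => exact funext fun r => r.elim0
  | succ t ih =>
    have hcount : pickCount (fun r : Fin t => (pick r ω, roundOutput g U pick r ω))
        (pick t ω) = pulls pick t (pick t ω) ω := by
      rw [pickCount, pulls, Finset.card_filter, Finset.card_filter,
        Finset.sum_range fun r => if pick r ω = pick t ω then 1 else 0]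
    rw [history, ih]
    funext r
    refine Fin.lastCases ?_ (fun r => ?_) r
    · simp only [Fin.snoc_last, Fin.val_last, nextQuery]
      rw [← h t ω, hcount, roundOutput]
    · simp only [Fin.snoc_castSucc, Fin.val_castSucc]

end Pulls

variable {Ω : Type*} {d : ℕ}

/-- The event that, before the `(t+1)`-st round, some sample variance leaves its confidence
interval in the direction that can make size `n` look better than the optimal size. It covers every
possible number `k` of pulls, so that it does not refer to the run. -/
def misleading (K : CostModel) (nStar n : BatchSize K.N) (c α β P S : ℝ)
    (g : EuclideanSpace ℝ (Fin d)) (U : NoiseIndex K.N → Ω → EuclideanSpace ℝ (Fin d)) (t : ℕ) :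
    Set Ω :=
  ⋃ k ∈ Finset.Icc 2 t,
    {ω | K.sigmaSq nStar * S + bonus c β P d (α * Real.log ((t : ℝ) + 1) / ((k : ℝ) - 1)) ≤
      (sampleCov g U nStar k ω).trace} ∪
    {ω | (sampleCov g U n k ω).trace ≤
      K.sigmaSq n * S - bonus c β P d (α * Real.log ((t : ℝ) + 1) / ((k : ℝ) - 1))}

section Run

variable {K : CostModel} {nStar n : BatchSize K.N} {c α β P S : ℝ}
  {g : EuclideanSpace ℝ (Fin d)} {U : NoiseIndex K.N → Ω → EuclideanSpace ℝ (Fin d)}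

/-- Unless the observations are misleading, a suboptimal size is picked only while the number of its
pulls is of logarithmic order. -/
lemma pulls_le_of_not_misleading {Ξ : Type*} [MeasurableSpace Ξ] {seed : Ω → Ξ}
    {rule : (t : ℕ) → Ξ × (Fin t → BatchSize K.N × EuclideanSpace ℝ (Fin d)) → BatchSize K.N}
    {pick : ℕ → Ω → BatchSize K.N} (hrun : IsRun c α β P g U seed rule pick)
    (hc : 0 < c) (hb : 0 < β * P) (hd : 0 < d) (hα : 0 < α) (hS : 0 < S)
    (hgap : 0 < K.gap nStar n) {t : ℕ} (ht : 2 * K.N ≤ t) {ω : Ω} (hpick : pick t ω = n)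
    (hω : ω ∉ misleading K nStar n c α β P S g U t) :
    (pulls pick t n ω : ℝ) - 1 ≤
      α * Real.log ((t : ℝ) + 1) / phi c β P d (K.gap nStar n * S / 2) := by
  have hγ : ∀ m : BatchSize K.N, pulls pick t m ω ∈ Finset.Icc 2 t := fun m =>
    Finset.mem_Icc.mpr ⟨hrun.init m ω ▸ pulls_mono m ω ht, pulls_le t m ω⟩
  have hsel := hrun.select t ht ω nStar
  rw [hpick] at hsel
  simp only [misleading, Set.mem_iUnion, not_exists, Set.mem_union, Set.mem_ofPred_eq, not_or,
    not_le] at hω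
  have h1 := (hω _ (hγ nStar)).1
  have h2 := (hω _ (hγ n)).2
  simp only [sampleTrace] at hsel
  have h3 : 2 ≤ pulls pick t n ω := (Finset.mem_Icc.mp (hγ n)).1
  have h3' : (2 : ℝ) ≤ pulls pick t n ω := by exact_mod_cast h3
  have hlog : 0 ≤ Real.log ((t : ℝ) + 1) := Real.log_nonneg (by linarith [t.cast_nonneg (α := ℝ)])
  set x : ℝ := α * Real.log ((t : ℝ) + 1) / ((pulls pick t n ω : ℝ) - 1) with hx
  have hx0 : 0 ≤ x := div_nonneg (by positivity) (by linarith)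
  have hle : K.gap nStar n * S / 2 ≤ bonus c β P d x := by
    rw [CostModel.gap]
    linarith
  have hφ := phi_mono hc hb (d := d) (by positivity) hle
  rw [phi_bonus hc hb hd hx0, hx, le_div_iff₀ (by linarith)] at hφ
  rw [le_div_iff₀ (phi_pos hc hb hd (by positivity))]
  linarith

/-- Pathwise bound on the pulls of a suboptimal size: a logarithmic term, the initial pulls, and
the number of misleading rounds. -/
lemma pulls_le_log_add {Ξ : Type*} [MeasurableSpace Ξ] {seed : Ω → Ξ}
    {rule : (t : ℕ) → Ξ × (Fin t → BatchSize K.N × EuclideanSpace ℝ (Fin d)) → BatchSize K.N}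
    {pick : ℕ → Ω → BatchSize K.N} (hrun : IsRun c α β P g U seed rule pick)
    (hc : 0 < c) (hb : 0 < β * P) (hd : 0 < d) (hα : 0 < α) (hS : 0 < S)
    (hgap : 0 < K.gap nStar n) {T : ℕ} (hT : 1 ≤ T) (ω : Ω) :
    (pulls pick T n ω : ℝ) ≤
      α * Real.log T / phi c β P d (K.gap nStar n * S / 2) + 2 +
        ∑ t ∈ Finset.Ico (2 * K.N) T,
          (misleading K nStar n c α β P S g U t).indicator (fun _ => (1 : ℝ)) ω := by
  have hφ := phi_pos (β := β) (P := P) hc hb hd (show 0 < K.gap nStar n * S / 2 by positivity)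
  set u : ℝ := α * Real.log T / phi c β P d (K.gap nStar n * S / 2) with hu
  have hT' : (1 : ℝ) ≤ T := by exact_mod_cast hT
  have hu0 : 0 ≤ u := div_nonneg (mul_nonneg hα.le (Real.log_nonneg hT')) hφ.le
  rcases le_total T (2 * K.N) with h | h
  · rw [Finset.Ico_eq_empty_of_le h, Finset.sum_empty]
    have : pulls pick T n ω ≤ 2 := hrun.init n ω ▸ pulls_mono n ω h
    have : (pulls pick T n ω : ℝ) ≤ 2 := by exact_mod_cast this
    linarith
  suffices H : ∀ t, 2 * K.N ≤ t → t ≤ T → (pulls pick t n ω : ℝ) ≤ u + 2 +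
      ∑ r ∈ Finset.Ico (2 * K.N) t,
        (misleading K nStar n c α β P S g U r).indicator (fun _ => (1 : ℝ)) ω from H T h le_rfl
  intro t ht
  induction t, ht using Nat.le_induction with
  | base =>
    intro _
    rw [hrun.init n ω, Finset.Ico_self, Finset.sum_empty]
    push_cast
    linarith
  | succ t ht ih =>
    intro htT
    have ih := ih (by omega)
    have hs0 : 0 ≤ ∑ r ∈ Finset.Ico (2 * K.N) t,
        (misleading K nStar n c α β P S g U r).indicator (fun _ => (1 : ℝ)) ω :=
      Finset.sum_nonneg fun r _ => Set.indicator_nonneg (fun _ _ => zero_le_one) _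
    rw [pulls_succ, Finset.sum_Ico_succ_top ht]
    by_cases hω : ω ∈ misleading K nStar n c α β P S g U t
    · rw [Set.indicator_of_mem hω]
      split_ifs <;> push_cast <;> linarith
    · rw [Set.indicator_of_notMem hω]
      by_cases hp : pick t ω = n
      · have h1 := pulls_le_of_not_misleading hrun hc hb hd hα hS hgap ht hp hω
        have h2 : α * Real.log ((t : ℝ) + 1) / phi c β P d (K.gap nStar n * S / 2) ≤ u := by
          rw [hu]
          have : (t : ℝ) + 1 ≤ T := by exact_mod_cast htT
          gcongr
        rw [if_pos hp]
        push_cast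
        linarith
      · rw [if_neg hp]
        push_cast
        linarith

variable [MeasurableSpace Ω] {μ : Measure Ω}

lemma measurableSet_misleading (hU : ∀ i, Measurable (U i)) (t : ℕ) :
    MeasurableSet (misleading K nStar n c α β P S g U t) := by
  refine Finset.measurableSet_biUnion _ fun k hk => ?_
  have hk2 := (Finset.mem_Icc.mp hk).1
  exact (measurableSet_le measurable_const (measurable_sampleCov_trace hU nStar hk2)).union
    (measurableSet_le (measurable_sampleCov_trace hU n hk2) measurable_const)

/-- Each of the at most `2 (t + 1)` deviations making up a misleading round has probability at most
`(t + 1) ^ (-α)`. -/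
lemma measure_misleading_le [IsProbabilityMeasure μ] {M : Matrix (Fin d) (Fin d) ℝ}
    (hU : ∀ i, IsGradientNoise μ M (K.fidelity i.1) (U i)) (hind : iIndepFun U μ) (hd : 0 < d)
    (hM : ∀ i, 0 < M i i) (hα : 0 < α) (hβ : ∀ n : BatchSize K.N, K.sigmaSq n ≤ β)
    (hP : M.trace ≤ P) (hb : 0 < β * P) (t : ℕ) :
    μ.real (misleading K nStar n (1 / 16384) α β P M.trace g U t) ≤
      2 * ((t : ℝ) + 1) ^ (1 - α) := by
  have ht0 : (0 : ℝ) < (t : ℝ) + 1 := by positivity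
  have hlog : 0 ≤ Real.log ((t : ℝ) + 1) := Real.log_nonneg (by linarith [t.cast_nonneg (α := ℝ)])
  have hone : ∀ k ∈ Finset.Icc 2 t, Real.exp (-(((k : ℝ) - 1) * phi (1 / 16384) β P d
      (bonus (1 / 16384) β P d (α * Real.log ((t : ℝ) + 1) / ((k : ℝ) - 1))))) =
      ((t : ℝ) + 1) ^ (-α) := by
    intro k hk
    have hk2 : (2 : ℝ) ≤ k := by exact_mod_cast (Finset.mem_Icc.mp hk).1
    have hk1 : (0 : ℝ) < (k : ℝ) - 1 := by linarith
    rw [phi_bonus (by norm_num) hb hd (by positivity), mul_div_cancel₀ _ hk1.ne',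
      Real.rpow_def_of_pos ht0]
    congr 1
    ring
  calc μ.real (misleading K nStar n (1 / 16384) α β P M.trace g U t)
      ≤ ∑ k ∈ Finset.Icc 2 t, 2 * ((t : ℝ) + 1) ^ (-α) := by
        refine (measureReal_biUnion_finset_le _ _).trans (Finset.sum_le_sum fun k hk => ?_)
        have hk2 := (Finset.mem_Icc.mp hk).1
        refine (measureReal_union_le _ _).trans ?_
        have h1 := (sampleCov_trace_tail (g := g) (θ := fun n => K.fidelity n) hU hind nStar hd
          (K.fidelity_pos nStar) hM (hβ nStar) hP hk2 (bonus_nonneg (c := 1 / 16384) hb d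
            (α * Real.log ((t : ℝ) + 1) / ((k : ℝ) - 1)))).1
        have h2 := (sampleCov_trace_tail (g := g) (θ := fun n => K.fidelity n) hU hind n hd
          (K.fidelity_pos n) hM (hβ n) hP hk2 (bonus_nonneg (c := 1 / 16384) hb d
            (α * Real.log ((t : ℝ) + 1) / ((k : ℝ) - 1)))).2
        rw [hone k hk] at h1 h2
        rw [two_mul]
        exact add_le_add h1 h2
    _ ≤ ((t : ℝ) + 1) * (2 * ((t : ℝ) + 1) ^ (-α)) := by
        rw [Finset.sum_const, nsmul_eq_mul, Nat.card_Icc]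
        gcongr
        have : t + 1 - 2 ≤ t + 1 := Nat.sub_le _ _
        exact_mod_cast this
    _ = 2 * ((t : ℝ) + 1) ^ (1 - α) := by
        rw [sub_eq_add_neg, Real.rpow_add ht0, Real.rpow_one]
        ring

/-- The expected sum of the variances `σ²` of the sizes picked in `T` rounds. -/
lemma integral_sum_sigmaSq_pick_le [IsProbabilityMeasure μ] {M : Matrix (Fin d) (Fin d) ℝ}
    (hU : ∀ i, IsGradientNoise μ M (K.fidelity i.1) (U i)) (hind : iIndepFun U μ) (hd : 0 < d)
    (hM : ∀ i, 0 < M i i) (hα : 2 < α) (hβ : ∀ n : BatchSize K.N, K.sigmaSq n ≤ β)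
    (hP : M.trace ≤ P) (hStar : K.IsOptimal nStar) {Ξ : Type*} [MeasurableSpace Ξ] {seed : Ω → Ξ}
    {rule : (t : ℕ) → Ξ × (Fin t → BatchSize K.N × EuclideanSpace ℝ (Fin d)) → BatchSize K.N}
    {pick : ℕ → Ω → BatchSize K.N} (hrun : IsRun (1 / 16384) α β P g U seed rule pick)
    {T : ℕ} (hT : 1 ≤ T) :
    ∫ ω, ∑ r ∈ Finset.range T, K.sigmaSq (pick r ω) ∂μ ≤
      T * K.sigmaSq nStar + Real.log T * constC₁ K nStar (1 / 16384) α β P d M.trace +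
        constC₂ K nStar α := by
  have hS : 0 < M.trace := by
    have : Nonempty (Fin d) := ⟨⟨0, hd⟩⟩
    exact Finset.sum_pos (fun i _ => hM i) Finset.univ_nonempty
  have hb : 0 < β * P :=
    mul_pos ((K.sigmaSq_pos nStar).trans_le (hβ nStar)) (hS.trans_le hP)
  have hN : 1 ≤ 2 * K.N := by
    have := Finset.mem_Icc.mp nStar.2
    omega
  have hgap0 : ∀ n, 0 ≤ K.gap nStar n := fun n => sub_nonneg.mpr (hStar n)
  set A : Finset (BatchSize K.N) := Finset.univ.filter fun n => 0 < K.gap nStar n with hA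
  set φ : BatchSize K.N → ℝ := fun n => phi (1 / 16384) β P d (K.gap nStar n * M.trace / 2) with hφ
  set ind : BatchSize K.N → ℕ → Ω → ℝ := fun n t =>
    (misleading K nStar n (1 / 16384) α β P M.trace g U t).indicator (fun _ => (1 : ℝ)) with hindic
  have hms : ∀ n t, MeasurableSet (misleading K nStar n (1 / 16384) α β P M.trace g U t) :=
    fun n t => measurableSet_misleading (fun i => (hU i).measurable) t
  have hindint : ∀ n t, Integrable (ind n t) μ := fun n t =>
    (integrable_const _).indicator (hms n t)
  have hpt : ∀ ω, ∑ r ∈ Finset.range T, K.sigmaSq (pick r ω) ≤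
      T * K.sigmaSq nStar + ∑ n ∈ A, K.gap nStar n *
        (α * Real.log T / φ n + 2 + ∑ t ∈ Finset.Ico (2 * K.N) T, ind n t ω) := by
    intro ω
    have h1 : ∑ r ∈ Finset.range T, K.sigmaSq (pick r ω) = T * K.sigmaSq nStar +
        ∑ n ∈ A, K.gap nStar n * pulls pick T n ω := by
      have h2 : ∑ n ∈ A, K.gap nStar n * pulls pick T n ω =
          ∑ n, K.gap nStar n * pulls pick T n ω := by
        rw [hA, Finset.sum_filter]
        refine Finset.sum_congr rfl fun n _ => ?_
        split_ifs with h
        · rfl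
        · rw [le_antisymm (not_lt.mp h) (hgap0 n), zero_mul]
      have h3 : ∑ n, K.gap nStar n * pulls pick T n ω =
          ∑ r ∈ Finset.range T, K.gap nStar (pick r ω) := by
        simp only [pulls, Finset.card_filter]
        push_cast
        simp_rw [Finset.mul_sum]
        rw [Finset.sum_comm]
        refine Finset.sum_congr rfl fun r _ => ?_
        simp
      rw [h2, h3]
      simp only [CostModel.gap, Finset.sum_sub_distrib, Finset.sum_const, Finset.card_range,
        nsmul_eq_mul]
      ring
    rw [h1]
    gcongr with n hn
    · exact hgap0 n
    · exact pulls_le_log_add hrun (by norm_num) hb hd (by linarith) hS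
        (Finset.mem_filter.mp hn).2 hT ω
  have hterm : ∀ n, Integrable (fun ω => K.gap nStar n *
      (α * Real.log T / φ n + 2 + ∑ t ∈ Finset.Ico (2 * K.N) T, ind n t ω)) μ := fun n =>
    ((integrable_const _).add (integrable_finsetSum _ fun t _ => hindint n t)).const_mul _
  have hrhs : Integrable (fun ω => T * K.sigmaSq nStar + ∑ n ∈ A, K.gap nStar n *
        (α * Real.log T / φ n + 2 + ∑ t ∈ Finset.Ico (2 * K.N) T, ind n t ω)) μ :=
    (integrable_const _).add (integrable_finsetSum _ fun n _ => hterm n)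
  refine (integral_mono_of_nonneg (ae_of_all _ fun ω => Finset.sum_nonneg fun r _ =>
    (K.sigmaSq_pos _).le) hrhs (ae_of_all _ hpt)).trans ?_
  rw [integral_add (integrable_const _) (integrable_finsetSum _ fun n _ => hterm n),
    integral_finsetSum _ fun n _ => hterm n, integral_const, probReal_univ, one_smul, add_assoc]
  gcongr
  have hone : ∀ n, ∫ ω, K.gap nStar n *
      (α * Real.log T / φ n + 2 + ∑ t ∈ Finset.Ico (2 * K.N) T, ind n t ω) ∂μ ≤
      Real.log T * (α * K.gap nStar n / φ n) + K.gap nStar n * (2 * (α - 1) / (α - 2)) := by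
    intro n
    have hα2 : α - 2 ≠ 0 := by linarith
    rw [integral_const_mul, integral_add (integrable_const _)
      (integrable_finsetSum _ fun t _ => hindint n t), integral_const, probReal_univ, one_smul,
      integral_finsetSum _ fun t _ => hindint n t]
    have h1 : ∑ t ∈ Finset.Ico (2 * K.N) T, ∫ ω, ind n t ω ∂μ ≤ 2 / (α - 2) := by
      refine le_trans (Finset.sum_le_sum fun t _ => ?_) (sum_rpow_one_sub_le hα hN)
      rw [hindic, integral_indicator_const _ (hms n t), smul_eq_mul, mul_one]
      exact measure_misleading_le hU hind hd hM (by linarith) hβ hP hb t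
    calc K.gap nStar n * (α * Real.log T / φ n + 2 +
          ∑ t ∈ Finset.Ico (2 * K.N) T, ∫ ω, ind n t ω ∂μ)
        ≤ K.gap nStar n * (α * Real.log T / φ n + 2 + 2 / (α - 2)) := by
          have := hgap0 n
          gcongr
      _ = Real.log T * (α * K.gap nStar n / φ n) +
          K.gap nStar n * (2 * (α - 1) / (α - 2)) := by
          rw [show 2 * (α - 1) / (α - 2) = 2 + 2 / (α - 2) by field_simp; ring]
          ring
  have hfac : 0 ≤ 2 * (α - 1) / (α - 2) := div_nonneg (by linarith) (by linarith)
  calc _ ≤ ∑ n ∈ A, (Real.log T * (α * K.gap nStar n / φ n) +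
        K.gap nStar n * (2 * (α - 1) / (α - 2))) := Finset.sum_le_sum fun n _ => hone n
    _ = Real.log T * ∑ n ∈ A, α * K.gap nStar n / φ n +
        (∑ n ∈ A, K.gap nStar n) * (2 * (α - 1) / (α - 2)) := by
        rw [Finset.sum_add_distrib, Finset.mul_sum, Finset.sum_mul]
    _ ≤ _ := by
        refine add_le_add le_rfl (mul_le_mul_of_nonneg_right ?_ hfac)
        exact Finset.sum_le_sum_of_subset_of_nonneg (Finset.filter_subset _ _)
          fun n _ _ => hgap0 n

end Run

/-- Error of a nonanticipating sequence of queries: the average of `T` outputs has mean squared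
error `tr M / T²` times the expected sum of the variances of the sizes picked. -/
lemma estimate_error [MeasurableSpace Ω] {μ : Measure Ω} [IsProbabilityMeasure μ]
    {K : CostModel} {M : Matrix (Fin d) (Fin d) ℝ} {g : EuclideanSpace ℝ (Fin d)}
    {U : NoiseIndex K.N → Ω → EuclideanSpace ℝ (Fin d)}
    (hU : ∀ i, IsGradientNoise μ M (K.fidelity i.1) (U i)) (hind : iIndepFun U μ)
    {Ξ : Type*} [MeasurableSpace Ξ] {seed : Ω → Ξ} (hseed : Measurable seed)
    (hseedU : IndepFun seed (fun ω i => U i ω) μ)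
    {rule : (t : ℕ) → Ξ × (Fin t → BatchSize K.N × EuclideanSpace ℝ (Fin d)) → BatchSize K.N}
    (hrule : ∀ t, Measurable (rule t)) {pick : ℕ → Ω → BatchSize K.N}
    (hpick : ∀ t ω, pick t ω =
      rule t (seed ω, fun r : Fin t => (pick r ω, roundOutput g U pick r ω)))
    {T : ℕ} (hT : 1 ≤ T) :
    Integrable (fun ω => ‖estimate g U pick T ω - g‖ ^ 2) μ ∧
      ∫ ω, ‖estimate g U pick T ω - g‖ ^ 2 ∂μ =
        1 / (T : ℝ) ^ 2 * (∫ ω, ∑ r ∈ Finset.range T, K.sigmaSq (pick r ω) ∂μ) * M.trace := by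
  have hmU : ∀ i, Measurable (U i) := fun i => (hU i).measurable
  have hmom := fun q : BatchSize K.N × ℕ =>
    oracle_moments (g := g) (θ := fun n => K.fidelity n) hU hind q.1 q.2
  obtain ⟨hL, hI⟩ := integral_norm_sq_sum_outputs (μ := μ)
    (X := fun q : BatchSize K.N × ℕ => oracle g U q.1 q.2)
    (fun q => measurable_oracle hmU q.1 q.2) hseed (iIndepFun_oracle hmU hind)
    (indepFun_seed_oracle hseedU) hrule (history_eq_of_nonanticipating hpick)
    (v := fun n => K.sigmaSq n * M.trace) (fun q => (hmom q).1) (fun q => (hmom q).2.1)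
    (fun q => (hmom q).2.2) T
  have hT0 : (T : ℝ) ≠ 0 := by positivity
  have heq : ∀ ω, ‖estimate g U pick T ω - g‖ ^ 2 =
      1 / (T : ℝ) ^ 2 * ‖∑ r ∈ Finset.range T, (roundOutput g U pick r ω - g)‖ ^ 2 := by
    intro ω
    have : estimate g U pick T ω - g =
        (1 / (T : ℝ)) • ∑ r ∈ Finset.range T, (roundOutput g U pick r ω - g) := by
      rw [Finset.sum_sub_distrib, Finset.sum_const, Finset.card_range, smul_sub, estimate,
        ← Nat.cast_smul_eq_nsmul ℝ, smul_smul, one_div_mul_cancel hT0, one_smul]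
    rw [this, norm_smul, mul_pow, Real.norm_of_nonneg (by positivity), div_pow, one_pow]
  simp_rw [heq]
  refine ⟨(hL.integrable_norm_pow two_ne_zero).const_mul _, ?_⟩
  rw [integral_const_mul, hI, mul_assoc, ← integral_mul_const]
  simp_rw [Finset.sum_mul]

end Bandit

end EEGrad

/-- `μ` is the conditional law, given the current iterate `w`, of the randomness of one iteration;
the constant `c` is universal. -/
theorem theorem1 :
    ∃ c : ℝ, 0 < c ∧
      ∀ (d : ℕ) (_hd : 0 < d)
        -- objective, current iterate, noise shape, cost-fidelity model, optimal mini-batch size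
        (F : EuclideanSpace ℝ (Fin d) → ℝ) (_hF : Differentiable ℝ F)
        (M : EuclideanSpace ℝ (Fin d) → Matrix (Fin d) (Fin d) ℝ)
        (w : EuclideanSpace ℝ (Fin d)) (_hM : (M w).PosDef) (_hMdiag : (M w).IsDiag)
        (K : EEGrad.CostModel) (nStar : EEGrad.BatchSize K.N) (_hStar : K.IsOptimal nStar)
        -- independent perturbations of the individual stochastic gradients
        (Ω : Type*) [MeasurableSpace Ω] (μ : Measure Ω) [IsProbabilityMeasure μ]
        (U : EEGrad.NoiseIndex K.N → Ω → EuclideanSpace ℝ (Fin d))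
        (_hU : ∀ i, EEGrad.IsGradientNoise μ (M w) (K.fidelity i.1) (U i))
        (_hindep : iIndepFun U μ)
        (T : ℕ) (_hT : 1 ≤ T),
        -- the bound for every run of EE-Grad; `seed` is external randomness for breaking ties
        (∀ (α β P : ℝ) (_hα : 2 < α)
            (_hβ : ∀ n : EEGrad.BatchSize K.N, K.sigmaSq n ≤ β) (_hP : (M w).trace ≤ P)
            (Ξ : Type*) [MeasurableSpace Ξ] (seed : Ω → Ξ) (_hseed : Measurable seed)
            (_hseedU : IndepFun seed (fun ω i => U i ω) μ)
            (rule : (t : ℕ) →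
              Ξ × (Fin t → EEGrad.BatchSize K.N × EuclideanSpace ℝ (Fin d)) →
                EEGrad.BatchSize K.N)
            (pick : ℕ → Ω → EEGrad.BatchSize K.N)
            (_hrun : EEGrad.IsRun c α β P (gradient F w) U seed rule pick),
            Integrable
              (fun ω => ‖EEGrad.estimate (gradient F w) U pick T ω - gradient F w‖ ^ 2) μ ∧
            ∫ ω, ‖EEGrad.estimate (gradient F w) U pick T ω - gradient F w‖ ^ 2 ∂μ ≤
              EEGrad.boundZ K nStar c α β P d (M w).trace T * (M w).trace) ∧
        -- the optimal mini-batch oracle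
        (Integrable
            (fun ω => ‖EEGrad.optimalEstimate (gradient F w) U nStar T ω - gradient F w‖ ^ 2) μ ∧
          ∫ ω, ‖EEGrad.optimalEstimate (gradient F w) U nStar T ω - gradient F w‖ ^ 2 ∂μ =
            K.sigmaSq nStar / T * (M w).trace) := by
  refine ⟨1 / 16384, by norm_num, ?_⟩
  intro d hd F _ M w hM _ K nStar hStar Ω _ μ _ U hU hind T hT
  have hMii : ∀ i, 0 < M w i i := fun i => hM.diag_pos
  have hS : 0 ≤ (M w).trace := Finset.sum_nonneg fun i _ => (hMii i).le
  have hT0 : (0 : ℝ) < T := by exact_mod_cast hT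
  constructor
  · intro α β P hα hβ hP Ξ _ seed hseed hseedU rule pick hrun
    obtain ⟨hint, herr⟩ := EEGrad.estimate_error hU hind hseed hseedU hrun.rule_measurable
      hrun.nonanticipating hT
    refine ⟨hint, herr.trans_le ?_⟩
    have hsum := EEGrad.integral_sum_sigmaSq_pick_le hU hind hd hMii hα hβ hP hStar hrun hT
    refine mul_le_mul_of_nonneg_right ?_ hS
    refine (mul_le_mul_of_nonneg_left hsum (by positivity)).trans_eq ?_
    rw [EEGrad.boundZ]
    field_simp
  · -- The optimal oracle is the run of the constant decision rule.
    have hpulls : ∀ t ω, EEGrad.pulls (fun (_ : ℕ) (_ : Ω) => nStar) t nStar ω = t := by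
      intro t ω
      simp [EEGrad.pulls]
    have hopt : EEGrad.optimalEstimate (gradient F w) U nStar T =
        EEGrad.estimate (gradient F w) U (fun _ _ => nStar) T := by
      funext ω
      simp only [EEGrad.optimalEstimate, EEGrad.estimate, EEGrad.roundOutput, hpulls]
    obtain ⟨hint, herr⟩ := EEGrad.estimate_error (g := gradient F w) hU hind
      (seed := fun _ => PUnit.unit.{1}) measurable_const (indepFun_const_left _ _)
      (rule := fun _ _ => nStar) (fun _ => measurable_const) (pick := fun _ _ => nStar)
      (fun _ _ => rfl) hT
    rw [hopt]
    refine ⟨hint, herr.trans ?_⟩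
    rw [Finset.sum_const, Finset.card_range, integral_const, probReal_univ, nsmul_eq_mul,
      smul_eq_mul]
    field_simp
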